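/- Let $M$ be a closed (compact, without boundary) connected smooth manifold of dimension $n$. For a Riemannian metric $g$ on $M$, a smooth non-constant function $f : M \to \mathbb{R}$ is called isoparametric on $(M,g)$ if there are a smooth function $b$ and a continuous function $a$ on the range $f(M)$ such that $\|\nabla_g f\|_g^2 = b\circ f$ and $\Delta_g f = a \circ f$, where $\Delta_g$ is the Laplace–Beltrami operator. Let $S_f$ be the set of functions on $M$ that are constant along the level sets of $f$, let $[g]$ be the set of Riemannian metrics of the form $\phi g$ with $\phi$ a smooth positive function on $M$, and let $[g]_f$ be the set of the metrics $\phi g \in [g]$ with $\phi \in S_f$. **Proposition.** Let $f$ be an isoparametric function on $(M,g)$ and let $h \in [g]$. Then $f$ is an isoparametric function on $(M,h)$ if and only if $[h]_f = [g]_f$. Moreover, if $h = \phi g$ with $\phi$ smooth and positive, then $[h]_f = [g]_f$ if and only if $\phi \in S_f$. -/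

import Mathlib

open scoped Manifold ContDiff

noncomputable section

namespace Isoparametric

/-- A smooth Riemannian metric on an `n`-dimensional smooth manifold without boundary. -/
abbrev Metric (n : ℕ) (M : Type*) [TopologicalSpace M]
    [ChartedSpace (EuclideanSpace ℝ (Fin n)) M] [IsManifold (𝓡 n) ∞ M] :=
  Bundle.ContMDiffRiemannianMetric (𝓡 n) ∞ (EuclideanSpace ℝ (Fin n))
    (fun x : M => TangentSpace (𝓡 n) x)

section

variable {n : ℕ} {M : Type*} [TopologicalSpace M]
  [ChartedSpace (EuclideanSpace ℝ (Fin n)) M] [IsManifold (𝓡 n) ∞ M]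

/-- The inner product `g_x` as a bilinear form on the tangent space at `x`. -/
def metricForm (g : Metric n M) (x : M) :
    LinearMap.BilinForm ℝ (TangentSpace (𝓡 n) x) :=
  LinearMap.mk₂ ℝ (fun v w => g.inner x v w) (by simp) (by simp) (by simp) (by simp)

instance finiteDimensionalTangent (x : M) : FiniteDimensional ℝ (TangentSpace (𝓡 n) x) :=
  inferInstanceAs (FiniteDimensional ℝ (EuclideanSpace ℝ (Fin n)))

theorem metricForm_nondegenerate (g : Metric n M) (x : M) : (metricForm g x).Nondegenerate := by
  constructor
  · intro v hv
    by_contra hne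
    exact (g.pos x v hne).ne' (hv v)
  · intro v hv
    by_contra hne
    exact (g.pos x v hne).ne' (hv v)

/-- The differential of a real function at `x`, as a linear form on the tangent space. -/
def differential (f : M → ℝ) (x : M) : Module.Dual ℝ (TangentSpace (𝓡 n) x) :=
  (mfderiv (𝓡 n) 𝓘(ℝ, ℝ) f x).toLinearMap

/-- The Riemannian gradient of `f` at `x`: the vector that represents the differential of `f`. -/
def gradient (g : Metric n M) (f : M → ℝ) (x : M) : TangentSpace (𝓡 n) x :=
  ((metricForm g x).toDual (metricForm_nondegenerate g x)).symm (differential f x)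

theorem inner_gradient (g : Metric n M) (f : M → ℝ) (x : M) (v : TangentSpace (𝓡 n) x) :
    g.inner x (gradient g f x) v = mfderiv (𝓡 n) 𝓘(ℝ, ℝ) f x v :=
  LinearMap.BilinForm.apply_toDual_symm_apply
    (hB := metricForm_nondegenerate g x) (differential f x) v

/-- The squared norm of the Riemannian gradient. -/
def gradientNormSq (g : Metric n M) (f : M → ℝ) (x : M) : ℝ :=
  g.inner x (gradient g f x) (gradient g f x)

/-- The `i`-th coordinate vector field of the chart at `p`, at the point with coordinates `z`. -/
def coordVector (p : M) (i : Fin n) (z : EuclideanSpace ℝ (Fin n)) :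
    TangentSpace (𝓡 n) ((extChartAt (𝓡 n) p).symm z) :=
  mfderiv 𝓘(ℝ, EuclideanSpace ℝ (Fin n)) (𝓡 n) (extChartAt (𝓡 n) p).symm z
    (EuclideanSpace.single i (1 : ℝ))

/-- The matrix `(g_ij)` of the metric in the chart at `p`, at the point with coordinates `z`. -/
def gram (g : Metric n M) (p : M) (z : EuclideanSpace ℝ (Fin n)) :
    Matrix (Fin n) (Fin n) ℝ :=
  Matrix.of fun i j => g.inner ((extChartAt (𝓡 n) p).symm z) (coordVector p i z) (coordVector p j z)

/-- The density `√(det (g_ij))` of the Riemannian volume in the chart at `p`. -/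
def volumeDensity (g : Metric n M) (p : M) (z : EuclideanSpace ℝ (Fin n)) : ℝ :=
  Real.sqrt (gram g p z).det

/-- The coordinates of a vector field in the chart at `p`, at the point with coordinates `z`. -/
def coords (p : M) (X : (x : M) → TangentSpace (𝓡 n) x) (z : EuclideanSpace ℝ (Fin n)) :
    EuclideanSpace ℝ (Fin n) :=
  mfderiv (𝓡 n) 𝓘(ℝ, EuclideanSpace ℝ (Fin n)) (extChartAt (𝓡 n) p)
    ((extChartAt (𝓡 n) p).symm z) (X ((extChartAt (𝓡 n) p).symm z))

/-- The Riemannian divergence `(1 / √det g) ∑ⱼ ∂ⱼ (√det g Xʲ)` of a vector field at `p`,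
computed in the chart at `p`. -/
def divergence (g : Metric n M) (X : (x : M) → TangentSpace (𝓡 n) x) (p : M) : ℝ :=
  (volumeDensity g p (extChartAt (𝓡 n) p p))⁻¹ *
    ∑ j : Fin n, fderiv ℝ (fun z => volumeDensity g p z * coords p X z j)
      (extChartAt (𝓡 n) p p) (EuclideanSpace.single j (1 : ℝ))

/-- The Laplace–Beltrami operator `Δ_g f = div_g (∇_g f)`. -/
def laplacian (g : Metric n M) (f : M → ℝ) (p : M) : ℝ :=
  divergence g (gradient g f) p

/-- Isoparametric functions. The functions `b` and `a` matter only on the range of `f`. -/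
structure IsIsoparametric (g : Metric n M) (f : M → ℝ) : Prop where
  smooth : ContMDiff (𝓡 n) 𝓘(ℝ, ℝ) ∞ f
  nonconstant : ∃ x y, f x ≠ f y
  gradient_eq : ∃ b : ℝ → ℝ, ContDiffOn ℝ ∞ b (Set.range f) ∧
    ∀ x, gradientNormSq g f x = b (f x)
  laplacian_eq : ∃ a : ℝ → ℝ, ContinuousOn a (Set.range f) ∧ ∀ x, laplacian g f x = a (f x)

/-- The functions on `M` that are constant along the level sets of `f`. -/
def levelConstant (f : M → ℝ) : Set (M → ℝ) :=
  {φ | ∀ x y, f x = f y → φ x = φ y}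

/-- `h = φ g` with `φ` a smooth positive function. -/
structure IsConformalFactor (g h : Metric n M) (φ : M → ℝ) : Prop where
  smooth : ContMDiff (𝓡 n) 𝓘(ℝ, ℝ) ∞ φ
  pos : ∀ x, 0 < φ x
  eq : ∀ (x : M) (v w : TangentSpace (𝓡 n) x), h.inner x v w = φ x * g.inner x v w

/-- The conformal class `[g]`. -/
def conformalClass (g : Metric n M) : Set (Metric n M) :=
  {h | ∃ φ, IsConformalFactor g h φ}

/-- The `f`-conformal class `[g]_f`. -/
def fConformalClass (g : Metric n M) (f : M → ℝ) : Set (Metric n M) :=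
  {h | ∃ φ ∈ levelConstant f, IsConformalFactor g h φ}

end

end Isoparametric

end

noncomputable section

namespace Isoparametric

open Set Filter Topology MeasureTheory Bundle

/-! Write h = φg, and let b_g and b_h be the functions giving the squared gradient norms of f. Since
∇_h f = φ⁻¹∇_g f, they satisfy φ · b_h(f) = b_g(f), so off the critical set φ is a quotient of
functions of f. At a critical level c one divides this identity by f − c and passes to the limit: φ
· b_h'(c) = b_g'(c), with b_h'(c) ≠ 0. Two facts make this work. The zeros of b are simple, because
a double zero would give |df| ≤ C|f − c| near the level and hence f constant, by Grönwall and
connectedness (`derivWithin_ne_zero_of_zero`). And critical levels have empty interior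
(`not_eventually_eq_of_zero`), so the limit can be taken off the level.

Conversely let φ = β ∘ f. The difficulty is the smoothness of β on the closed interval f(M),
endpoints included (`contDiffOn_range_of_comp`). Where df ≠ 0 it follows from the inverse function
theorem on a line. A zero c of b is an extreme value of f, and there u = |f − c| is smooth and
satisfies u ≤ C|du|². If the Hessian vanished at such a point, u would vanish nearby
(`eventually_eq_zero_of_hessian_eq_zero`), which the empty interior forbids. So f has a
nondegenerate extremum along some line through the point, and one-variable calculus makes β
one-sidedly smooth (`contDiffOn_of_comp_fold`). The formula `laplacian_conformal` then expresses Δ_h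
f through f.

The statement on f-conformal classes holds because the conformal factor is determined by the two
metrics as soon as nonzero tangent vectors exist. -/

/-! ### One-variable calculus: Hadamard's lemma and factorization through a fold -/

/-- A smooth function on an open set agrees near any point with a globally smooth function. -/
theorem exists_contDiff_eventuallyEq {f : ℝ → ℝ} {U : Set ℝ} (hU : IsOpen U)
    (hf : ContDiffOn ℝ ∞ f U) {x : ℝ} (hx : x ∈ U) :
    ∃ F : ℝ → ℝ, ContDiff ℝ ∞ F ∧ F =ᶠ[𝓝 x] f := by
  obtain ⟨r, hr, hrU⟩ := Metric.nhds_basis_closedBall.mem_iff.1 (hU.mem_nhds hx)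
  let u : ContDiffBump x := ⟨r / 2, r, by positivity, by linarith⟩
  refine ⟨fun y => u y * f y, ?_, ?_⟩
  · refine contDiff_iff_contDiffAt.2 fun y => ?_
    by_cases hy : y ∈ U
    · exact u.contDiff.contDiffAt.mul (hf.contDiffAt (hU.mem_nhds hy))
    · have hy' : y ∈ (Metric.closedBall x r)ᶜ := fun h => hy (hrU h)
      have : (fun y => u y * f y) =ᶠ[𝓝 y] fun _ => 0 := by
        filter_upwards [Metric.isClosed_closedBall.isOpen_compl.mem_nhds hy'] with z hz
        rw [u.zero_of_le_dist, zero_mul]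
        exact (not_le.1 (fun h => hz (Metric.mem_closedBall.2 h))).le
      exact contDiffAt_const.congr_of_eventuallyEq this
  · filter_upwards [u.eventuallyEq_one] with y hy
    rw [hy]; simp

/-- Differentiation under the integral sign. The derivative has the same shape, with `k + 1` and
`deriv h`, so the formula can be iterated. -/
theorem hasDerivAt_integral_pow_mul {h : ℝ → ℝ} (hh : ContDiff ℝ 1 h) (k : ℕ) (s : ℝ) :
    HasDerivAt (fun s => ∫ t in (0 : ℝ)..1, t ^ k * h (t * s))
      (∫ t in (0 : ℝ)..1, t ^ (k + 1) * deriv h (t * s)) s := by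
  have hc : Continuous h := hh.continuous
  have hc' : Continuous (deriv h) := hh.continuous_deriv le_rfl
  obtain ⟨C, hC⟩ :=
    (isCompact_Icc (a := -(|s| + 1)) (b := |s| + 1)).exists_bound_of_continuousOn hc'.continuousOn
  refine (intervalIntegral.hasDerivAt_integral_of_dominated_loc_of_deriv_le
    (F := fun s t => t ^ k * h (t * s)) (F' := fun s t => t ^ (k + 1) * deriv h (t * s))
    (bound := fun _ => C) (Metric.ball_mem_nhds s one_pos) ?_ ?_ ?_ ?_ ?_ ?_).2
  · exact Eventually.of_forall fun x => (by fun_prop : Continuous _).aestronglyMeasurable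
  · exact (by fun_prop : Continuous _).intervalIntegrable _ _
  · exact (by fun_prop : Continuous _).aestronglyMeasurable
  · refine Eventually.of_forall fun t ht x hx => ?_
    rw [uIoc_of_le zero_le_one] at ht
    have h1 : |t ^ (k + 1)| ≤ 1 := by
      rw [abs_of_nonneg (pow_nonneg ht.1.le _)]; exact pow_le_one₀ ht.1.le ht.2
    have hx' : |x| ≤ |s| + 1 := by
      have := Metric.mem_ball.1 hx
      rw [Real.dist_eq] at this
      have := abs_sub_abs_le_abs_sub x s
      linarith
    have h2 : ‖deriv h (t * x)‖ ≤ C := by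
      refine hC _ (abs_le.1 ?_)
      rw [abs_mul, abs_of_pos ht.1]
      nlinarith [abs_nonneg x, ht.1, ht.2]
    rw [norm_mul, Real.norm_eq_abs]
    nlinarith [norm_nonneg (deriv h (t * x)), abs_nonneg (t ^ (k + 1))]
  · exact intervalIntegrable_const
  · refine Eventually.of_forall fun t _ x _ => ?_
    have h1 : HasDerivAt h (deriv h (t * x)) (t * x) :=
      (hh.differentiable one_ne_zero _).hasDerivAt
    have h2 : HasDerivAt (fun x => t * x) t x := by simpa using (hasDerivAt_id x).const_mul t
    have := (h1.comp x h2).const_mul (t ^ k)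
    simpa only [pow_succ, mul_assoc, mul_comm t, Function.comp_def] using this

theorem contDiff_integral_pow_mul (m : ℕ) : ∀ {h : ℝ → ℝ}, ContDiff ℝ ∞ h → ∀ k : ℕ,
    ContDiff ℝ m (fun s => ∫ t in (0 : ℝ)..1, t ^ k * h (t * s)) := by
  induction m with
  | zero =>
    intro h hh k
    refine contDiff_zero.2 (continuous_iff_continuousAt.2 fun s => ?_)
    exact (hasDerivAt_integral_pow_mul (hh.of_le (by simp)) k s).continuousAt
  | succ m ih =>
    intro h hh k
    have hd := fun s => hasDerivAt_integral_pow_mul (hh.of_le (by simp)) k s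
    have : ((m + 1 : ℕ) : WithTop ℕ∞) = (m : WithTop ℕ∞) + 1 := by simp
    rw [this, contDiff_succ_iff_deriv]
    refine ⟨fun s => (hd s).differentiableAt, by simp, ?_⟩
    rw [show deriv (fun s => ∫ t in (0 : ℝ)..1, t ^ k * h (t * s)) = _ from
      funext fun s => (hd s).deriv]
    exact ih (contDiff_infty_iff_deriv.1 hh).2 (k + 1)

/-- Hadamard's lemma in one variable. -/
theorem exists_contDiff_eq_mul {f : ℝ → ℝ} (hf : ContDiff ℝ ∞ f) (h0 : f 0 = 0) :
    ∃ q : ℝ → ℝ, ContDiff ℝ ∞ q ∧ ∀ s, f s = s * q s := by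
  refine ⟨fun s => ∫ t in (0 : ℝ)..1, t ^ 0 * deriv f (t * s), ?_, fun s => ?_⟩
  · exact contDiff_infty.2 fun m =>
      contDiff_integral_pow_mul m (contDiff_infty_iff_deriv.1 hf).2 0
  · have hd : ∀ t : ℝ, HasDerivAt (fun t => f (t * s)) (s * deriv f (t * s)) t := fun t => by
      have h1 : HasDerivAt f (deriv f (t * s)) (t * s) :=
        (hf.differentiable (by simp) _).hasDerivAt
      have h2 : HasDerivAt (fun t => t * s) s t := by simpa using (hasDerivAt_id t).mul_const s
      simpa only [mul_comm s, Function.comp_def] using h1.comp t h2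
    have hc : Continuous fun t : ℝ => s * deriv f (t * s) := by
      have := (contDiff_infty_iff_deriv.1 hf).2.continuous
      fun_prop
    have := intervalIntegral.integral_eq_sub_of_hasDerivAt (a := 0) (b := 1)
      (fun t _ => hd t) (hc.intervalIntegrable _ _)
    simp only [intervalIntegral.integral_const_mul, one_mul, zero_mul, h0, sub_zero] at this
    simp [this]

/-- If `Φ = β ∘ F` near a regular point of `F`, then `β` is smooth near the image. -/
theorem contDiffAt_of_comp_regular {F Φ β : ℝ → ℝ} {s : ℝ} (hF : ContDiff ℝ ∞ F)
    (hΦ : ContDiff ℝ ∞ Φ) (hs : deriv F s ≠ 0) (h : ∀ᶠ t in 𝓝 s, Φ t = β (F t)) :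
    ContDiffAt ℝ ∞ β (F s) ∧ deriv β (F s) * deriv F s = deriv Φ s := by
  have hd : HasDerivAt F (deriv F s) s := (hF.differentiable (by simp) s).hasDerivAt
  have hd' : HasFDerivAt F
      (ContinuousLinearEquiv.unitsEquivAut ℝ (Units.mk0 _ hs) : ℝ →L[ℝ] ℝ) s := by
    have e : (ContinuousLinearEquiv.unitsEquivAut ℝ (Units.mk0 _ hs) : ℝ →L[ℝ] ℝ) =
        ContinuousLinearMap.toSpanSingleton ℝ (deriv F s) := by
      ext; simp
    rw [e]
    exact hd.hasFDerivAt
  have hinf : (∞ : WithTop ℕ∞) ≠ 0 := by simp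
  set G := (hF.contDiffAt (x := s)).localInverse hd' hinf with hG
  have hGs : ContDiffAt ℝ ∞ G (F s) := (hF.contDiffAt).to_localInverse hd' hinf
  have hG0 : G (F s) = s := hF.contDiffAt.localInverse_apply_image hd' hinf
  have hFG : ∀ᶠ y in 𝓝 (F s), F (G y) = y :=
    (hF.contDiffAt.hasStrictFDerivAt' hd' hinf).eventually_right_inverse
  have hβ : β =ᶠ[𝓝 (F s)] Φ ∘ G := by
    have ht : Tendsto G (𝓝 (F s)) (𝓝 s) := by
      have := hGs.continuousAt.tendsto; rwa [hG0] at this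
    filter_upwards [hFG, ht.eventually h] with y hy hy'
    simp [hy', hy]
  have hβs : ContDiffAt ℝ ∞ β (F s) :=
    (hΦ.contDiffAt.comp (F s) hGs).congr_of_eventuallyEq hβ
  refine ⟨hβs, ?_⟩
  have h1 := ((hβs.differentiableAt hinf).hasDerivAt).comp s hd
  have h2 : Φ =ᶠ[𝓝 s] β ∘ F := h
  rw [h2.deriv_eq, h1.deriv]

/-- By compactness and the intermediate value theorem, `F` restricts to a closed continuous
surjection of intervals, hence a quotient map, and continuity of `β` can be tested on `β ∘ F`. -/
theorem continuousOn_of_comp_strictMonoOn {F Φ β : ℝ → ℝ} {δ : ℝ} (hδ : 0 ≤ δ)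
    (hF : Continuous F) (hΦ : Continuous Φ) (hmono : StrictMonoOn F (Icc 0 δ))
    (h : ∀ t ∈ Icc 0 δ, Φ t = β (F t)) : ContinuousOn β (Icc (F 0) (F δ)) := by
  have hsurj : ∀ y ∈ Icc (F 0) (F δ), ∃ t ∈ Icc 0 δ, F t = y := fun y hy =>
    intermediate_value_Icc hδ hF.continuousOn hy
  have hmaps : MapsTo F (Icc 0 δ) (Icc (F 0) (F δ)) := fun t ht =>
    ⟨hmono.monotoneOn (left_mem_Icc.2 hδ) ht ht.1, hmono.monotoneOn ht (right_mem_Icc.2 hδ) ht.2⟩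
  let F' : Icc 0 δ → Icc (F 0) (F δ) := hmaps.restrict
  have hF' : Continuous F' := hF.continuousOn.mapsToRestrict hmaps
  have hq : IsQuotientMap F' := hF'.isClosedMap.isQuotientMap hF' (by
    rintro ⟨y, hy⟩
    obtain ⟨t, ht, rfl⟩ := hsurj y hy
    exact ⟨⟨t, ht⟩, rfl⟩)
  rw [continuousOn_iff_continuous_domRestrict, hq.continuous_iff]
  have : (Icc (F 0) (F δ)).domRestrict β ∘ F' = fun t => Φ t.1 := by
    funext t
    exact (h t t.2).symm
  rw [this]
  exact hΦ.comp continuous_subtype_val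

/-- Hadamard's lemma applied to F'; differentiating s · q(s) at 0 gives q(0) = F''(0). -/
theorem exists_fold_factor {F : ℝ → ℝ} (hF : ContDiff ℝ ∞ F) (h1 : deriv F 0 = 0)
    (h2 : 0 < deriv (deriv F) 0) :
    ∃ q : ℝ → ℝ, ContDiff ℝ ∞ q ∧ (∀ s, deriv F s = s * q s) ∧ 0 < q 0 := by
  obtain ⟨q, hq, hq'⟩ := exists_contDiff_eq_mul (contDiff_infty_iff_deriv.1 hF).2 h1
  refine ⟨q, hq, hq', ?_⟩
  have h3 := (hasDerivAt_id (0 : ℝ)).mul (hq.differentiable (by simp) 0).hasDerivAt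
  have h4 : deriv F = id * q := funext hq'
  rw [h4, h3.deriv] at h2
  simpa using h2

theorem exists_strictMonoOn_of_fold {F : ℝ → ℝ} (hF : ContDiff ℝ ∞ F) {q : ℝ → ℝ}
    (hq : Continuous q) (hq' : ∀ s, deriv F s = s * q s) (h0 : 0 < q 0) :
    ∃ δ > 0, (∀ s ∈ Icc (-δ) δ, 0 < q s) ∧ StrictMonoOn F (Icc 0 δ) ∧
      StrictAntiOn F (Icc (-δ) 0) := by
  obtain ⟨δ, hδ, hd⟩ := Metric.nhds_basis_closedBall.mem_iff.1
    (hq.continuousAt.eventually (lt_mem_nhds h0))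
  rw [Real.closedBall_eq_Icc] at hd
  simp only [zero_sub, zero_add] at hd
  refine ⟨δ, hδ, fun s hs => hd hs, ?_, ?_⟩
  · refine strictMonoOn_of_deriv_pos (convex_Icc _ _) hF.continuous.continuousOn fun s hs => ?_
    rw [interior_Icc] at hs
    rw [hq']
    exact mul_pos hs.1 (hd ⟨by linarith [hs.1], hs.2.le⟩)
  · refine strictAntiOn_of_deriv_neg (convex_Icc _ _) hF.continuous.continuousOn fun s hs => ?_
    rw [interior_Icc] at hs
    rw [hq']
    exact mul_neg_of_neg_of_pos hs.2 (hd ⟨hs.1.le, by linarith [hs.2]⟩)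

/-- A function of `F`, where `F` has a nondegenerate minimum at `0`, is critical at `0`. -/
theorem deriv_eq_zero_of_comp_fold {F Φ β : ℝ → ℝ} (hF : ContDiff ℝ ∞ F) (hΦ : ContDiff ℝ ∞ Φ)
    (h1 : deriv F 0 = 0) (h2 : 0 < deriv (deriv F) 0) (h : ∀ᶠ s in 𝓝 0, Φ s = β (F s)) :
    deriv Φ 0 = 0 := by
  by_contra hne
  obtain ⟨q, hq, hq', h0⟩ := exists_fold_factor hF h1 h2
  obtain ⟨δ, hδ, -, hm, ha⟩ := exists_strictMonoOn_of_fold hF hq.continuous hq' h0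
  have hc : Continuous (deriv Φ) := (contDiff_infty_iff_deriv.1 hΦ).2.continuous
  obtain ⟨η, hη, hd⟩ := Metric.nhds_basis_closedBall.mem_iff.1
    (h.and (hc.continuousAt.eventually (isOpen_ne.mem_nhds hne)))
  rw [Real.closedBall_eq_Icc] at hd
  simp only [zero_sub, zero_add] at hd
  set r := min δ η with hr
  have hr0 : 0 < r := lt_min hδ hη
  have hrδ : r ≤ δ := min_le_left _ _
  have hrη : r ≤ η := min_le_right _ _
  have hlt : F 0 < F (-r) :=
    ha ⟨by linarith, by linarith⟩ ⟨by linarith, le_rfl⟩ (by linarith)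
  have hev : ∀ᶠ s in 𝓝[>] (0 : ℝ), F s < F (-r) ∧ s ∈ Ioo 0 r :=
    ((hF.continuous.continuousAt.eventually (gt_mem_nhds hlt)).filter_mono nhdsWithin_le_nhds).and
      (Ioo_mem_nhdsGT hr0)
  obtain ⟨s, hs, hs0, hsr⟩ := hev.exists
  have hFs : F 0 < F s := hm ⟨le_rfl, hδ.le⟩ ⟨hs0.le, by linarith⟩ hs0
  -- The value at `s > 0` is taken again at some `s' ≤ 0`. Then `Φ` agrees at both points, and Rolle
  -- gives a zero of Φ' where it was assumed nonzero.
  obtain ⟨s', hs', hss⟩ : F s ∈ F '' Icc (-r) 0 :=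
    intermediate_value_Icc' (by linarith) hF.continuous.continuousOn ⟨hFs.le, hs.le⟩
  have e1 := (hd (show s ∈ Icc (-η) η from ⟨by linarith, by linarith⟩)).1
  have e2 := (hd (show s' ∈ Icc (-η) η from ⟨by linarith [hs'.1], by linarith [hs'.2]⟩)).1
  obtain ⟨ξ, hξ, hξ'⟩ := exists_deriv_eq_zero (show s' < s by linarith [hs'.2])
    hΦ.continuous.continuousOn (by rw [e1, e2, hss])
  exact (hd (show ξ ∈ Icc (-η) η from
    ⟨by linarith [hs'.1, hξ.1], by linarith [hξ.2]⟩)).2 hξ'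

/-- If `F` has a nondegenerate minimum at `0` and `Φ = β ∘ F` near `0`, with `F` and `Φ` smooth,
then `β` is as differentiable as one likes on the right of the minimal value. -/
theorem contDiffOn_of_comp_fold (k : ℕ) : ∀ {F Φ β : ℝ → ℝ}, ContDiff ℝ ∞ F → ContDiff ℝ ∞ Φ →
    deriv F 0 = 0 → 0 < deriv (deriv F) 0 → (∀ᶠ s in 𝓝 0, Φ s = β (F s)) →
    ∃ ε > 0, ContDiffOn ℝ k β (Icc (F 0) (F 0 + ε)) := by
  induction k with
  | zero =>
    intro F Φ β hF hΦ h1 h2 h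
    obtain ⟨q, hq, hq', h0⟩ := exists_fold_factor hF h1 h2
    obtain ⟨δ, hδ, -, hm, -⟩ := exists_strictMonoOn_of_fold hF hq.continuous hq' h0
    obtain ⟨η, hη, hd⟩ := Metric.nhds_basis_closedBall.mem_iff.1 h
    rw [Real.closedBall_eq_Icc] at hd
    simp only [zero_sub, zero_add] at hd
    set r := min δ η with hr
    have hr0 : 0 < r := lt_min hδ hη
    have hm' : StrictMonoOn F (Icc 0 r) := hm.mono (Icc_subset_Icc_right (min_le_left _ _))
    have hc := continuousOn_of_comp_strictMonoOn hr0.le hF.continuous hΦ.continuous hm'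
      (β := β) fun t ht => hd ⟨by linarith [ht.1], ht.2.trans (min_le_right _ _)⟩
    have hlt : F 0 < F r := hm' ⟨le_rfl, hr0.le⟩ ⟨hr0.le, le_rfl⟩ hr0
    refine ⟨F r - F 0, by linarith, ?_⟩
    simpa using hc
  | succ k ih =>
    intro F Φ β hF hΦ h1 h2 h
    obtain ⟨q, hq, hq', h0⟩ := exists_fold_factor hF h1 h2
    obtain ⟨δ, hδ, hqpos, hm, ha⟩ := exists_strictMonoOn_of_fold hF hq.continuous hq' h0
    -- Both Φ' = s · p and F' = s · q vanish at 0, so β' ∘ F = p / q extends smoothly across 0. Thus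
    -- β' satisfies the same hypotheses with p / q in place of Φ, and induction applies.
    obtain ⟨p, hp, hp'⟩ := exists_contDiff_eq_mul (contDiff_infty_iff_deriv.1 hΦ).2
      (deriv_eq_zero_of_comp_fold hF hΦ h1 h2 h)
    have hquot : ContDiffOn ℝ ∞ (fun s => p s / q s) {s | q s ≠ 0} :=
      hp.contDiffOn.div hq.contDiffOn fun s hs => hs
    obtain ⟨Φ₁, hΦ₁, hΦ₁'⟩ := exists_contDiff_eventuallyEq
      (isOpen_ne.preimage hq.continuous) hquot (x := 0) h0.ne'
    have hev : ∀ᶠ s in 𝓝 (0 : ℝ), s ∈ Icc (-δ) δ ∧ Φ₁ s = p s / q s ∧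
        ∀ᶠ t in 𝓝 s, Φ t = β (F t) :=
      (show ∀ᶠ s in 𝓝 (0 : ℝ), s ∈ Icc (-δ) δ from Icc_mem_nhds (neg_lt_zero.2 hδ) hδ).and (hΦ₁'.and h.eventually_nhds)
    obtain ⟨η, hη, hd⟩ := Metric.nhds_basis_closedBall.mem_iff.1 hev
    rw [Real.closedBall_eq_Icc] at hd
    simp only [zero_sub, zero_add] at hd
    have hηδ : η ≤ δ := (hd (show η ∈ Icc (-η) η from ⟨by linarith, le_rfl⟩)).1.2
    have hne : ∀ s ∈ Icc (-η) η, s ≠ 0 → F 0 < F s := by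
      intro s hs hs0
      rcases lt_or_gt_of_ne hs0 with hlt | hlt
      · exact ha ⟨by linarith [hs.1], hlt.le⟩ ⟨by linarith, le_rfl⟩ hlt
      · exact hm ⟨le_rfl, hδ.le⟩ ⟨hlt.le, by linarith [hs.2]⟩ hlt
    have hreg : ∀ s ∈ Icc (-η) η, s ≠ 0 →
        ContDiffAt ℝ ∞ β (F s) ∧ deriv β (F s) = Φ₁ s := by
      intro s hs hs0
      have hqs := hqpos s (hd hs).1
      have hFs : deriv F s ≠ 0 := by
        rw [hq']; exact mul_ne_zero hs0 hqs.ne'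
      obtain ⟨c1, c2⟩ := contDiffAt_of_comp_regular hF hΦ hFs (hd hs).2.2
      refine ⟨c1, ?_⟩
      rw [(hd hs).2.1, eq_div_iff hqs.ne']
      rw [hq', hp'] at c2
      apply mul_left_cancel₀ hs0
      linarith
    -- The factorization does not constrain `β` below the minimum, so `deriv β` says nothing at `F
    -- 0`; the one-sided derivative there is prescribed instead.
    let β₁ : ℝ → ℝ := fun t => if t = F 0 then Φ₁ 0 else deriv β t
    have hβ₁ : ∀ s ∈ Icc (-η) η, Φ₁ s = β₁ (F s) := by
      intro s hs
      by_cases hs0 : s = 0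
      · simp [β₁, hs0]
      · simp only [β₁, if_neg (hne s hs hs0).ne', (hreg s hs hs0).2]
    obtain ⟨ε, hε, hε'⟩ := ih hF hΦ₁ h1 h2 (β := β₁)
      (by filter_upwards [Icc_mem_nhds (show -η < 0 by linarith) hη] with s hs using hβ₁ s hs)
    have hmη : StrictMonoOn F (Icc 0 η) := hm.mono (Icc_subset_Icc_right hηδ)
    have hFη : F 0 < F η := hmη ⟨le_rfl, hη.le⟩ ⟨hη.le, le_rfl⟩ hη
    have hβc : ContinuousOn β (Icc (F 0) (F η)) :=
      continuousOn_of_comp_strictMonoOn hη.le hF.continuous hΦ.continuous hmη fun t ht =>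
        (hd (show t ∈ Icc (-η) η from ⟨by linarith [ht.1], ht.2⟩)).2.2.self_of_nhds
    have hβ₁c : ContinuousOn β₁ (Icc (F 0) (F η)) :=
      continuousOn_of_comp_strictMonoOn hη.le hF.continuous hΦ₁.continuous hmη fun t ht =>
        hβ₁ t ⟨by linarith [ht.1], ht.2⟩
    have hint : ∀ t ∈ Ioc (F 0) (F η), ContDiffAt ℝ ∞ β t := by
      intro t ht
      obtain ⟨s, hs, rfl⟩ := intermediate_value_Icc hη.le hF.continuous.continuousOn ⟨ht.1.le, ht.2⟩
      have hs0 : s ≠ 0 := by rintro rfl; exact lt_irrefl _ ht.1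
      exact (hreg s ⟨by linarith [hs.1], hs.2⟩ hs0).1
    -- At the endpoint, a continuous function whose derivative has a limit is one-sidedly
    -- differentiable with that limit as derivative.
    have hend : HasDerivWithinAt β (β₁ (F 0)) (Ici (F 0)) (F 0) := by
      refine hasDerivWithinAt_Ici_of_tendsto_deriv (s := Ioc (F 0) (F η))
        (fun t ht => ((hint t ht).differentiableAt (by simp)).differentiableWithinAt)
        ((hβc _ ⟨le_rfl, hFη.le⟩).mono Ioc_subset_Icc_self) (Ioc_mem_nhdsGT hFη) ?_
      have : Tendsto β₁ (𝓝[Ioc (F 0) (F η)] (F 0)) (𝓝 (β₁ (F 0))) :=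
        (hβ₁c _ ⟨le_rfl, hFη.le⟩).mono_left (nhdsWithin_mono _ Ioc_subset_Icc_self)
      rw [nhdsWithin_Ioc_eq_nhdsGT hFη] at this
      refine this.congr' ?_
      filter_upwards [self_mem_nhdsWithin] with t ht
      simp only [β₁, if_neg (show t ≠ F 0 from (ne_of_gt ht))]
    set ε' := min ε (F η - F 0) with hε'def
    have hε'0 : 0 < ε' := lt_min hε (by linarith)
    have hsub : ∀ t ∈ Icc (F 0) (F 0 + ε'), t ≤ F η := fun t ht => by
      have := min_le_right ε (F η - F 0)
      linarith [ht.2]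
    have hder : ∀ t ∈ Icc (F 0) (F 0 + ε'),
        HasDerivWithinAt β (β₁ t) (Icc (F 0) (F 0 + ε')) t := by
      intro t ht
      rcases eq_or_lt_of_le ht.1 with rfl | hlt
      · exact hend.mono Icc_subset_Ici_self
      · have hd' := ((hint t ⟨hlt, hsub t ht⟩).differentiableAt (by simp)).hasDerivAt
        simp only [β₁, if_neg hlt.ne']
        exact hd'.hasDerivWithinAt
    have huniq : UniqueDiffOn ℝ (Icc (F 0) (F 0 + ε')) := uniqueDiffOn_Icc (by linarith)
    refine ⟨ε', hε'0, ?_⟩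
    have hcast : ((k + 1 : ℕ) : WithTop ℕ∞) = (k : WithTop ℕ∞) + 1 := by simp
    rw [hcast, contDiffOn_succ_iff_derivWithin huniq]
    refine ⟨fun t ht => (hder t ht).differentiableWithinAt, by simp, ?_⟩
    refine (hε'.mono (Icc_subset_Icc_right ?_)).congr fun t ht => (hder t ht).derivWithin (huniq t ht)
    have := min_le_left ε (F η - F 0)
    linarith

/-- Smoothness at a point is checked order by order, so it does no harm that `ε` depends on `k`. -/
theorem contDiffWithinAt_Ici_of_comp_fold {F Φ β : ℝ → ℝ} (hF : ContDiff ℝ ∞ F)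
    (hΦ : ContDiff ℝ ∞ Φ) (h1 : deriv F 0 = 0) (h2 : 0 < deriv (deriv F) 0)
    (h : ∀ᶠ s in 𝓝 0, Φ s = β (F s)) : ContDiffWithinAt ℝ ∞ β (Ici (F 0)) (F 0) := by
  refine contDiffWithinAt_infty.2 fun k => ?_
  obtain ⟨ε, hε, hβ⟩ := contDiffOn_of_comp_fold k hF hΦ h1 h2 h
  exact (hβ (F 0) ⟨le_rfl, by linarith⟩).mono_of_mem_nhdsWithin
    (Icc_mem_nhdsGE (by linarith))

theorem contDiffWithinAt_Iic_of_comp_fold {F Φ β : ℝ → ℝ} (hF : ContDiff ℝ ∞ F)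
    (hΦ : ContDiff ℝ ∞ Φ) (h1 : deriv F 0 = 0) (h2 : deriv (deriv F) 0 < 0)
    (h : ∀ᶠ s in 𝓝 0, Φ s = β (F s)) : ContDiffWithinAt ℝ ∞ β (Iic (F 0)) (F 0) := by
  have hd : deriv (fun s => -F s) = fun s => -deriv F s := funext fun s => deriv.fun_neg
  have h3 := contDiffWithinAt_Ici_of_comp_fold (F := fun s => -F s) (β := fun t => β (-t))
    hF.neg hΦ (by rw [hd]; simp [h1]) (by rw [hd, deriv.fun_neg]; linarith) (by simpa using h)
  have h4 := ContDiffWithinAt.comp (F 0) (g := fun t => β (-t)) (f := fun t => -t)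
    (t := Ici (-F 0)) (s := Iic (F 0)) h3 contDiff_neg.contDiffWithinAt
    (fun t ht => neg_le_neg (mem_Iic.1 ht))
  simpa [Function.comp_def] using h4

/-! ### Two vanishing criteria for functions controlled by their gradient -/

section

variable {E : Type*} [NormedAddCommGroup E]

/-- A function whose derivative is dominated by its value vanishes near each of its zeros. -/
theorem eq_zero_of_norm_fderiv_le [NormedSpace ℝ E] {u : E → ℝ} {x₀ : E} {r K : ℝ}
    (hu : ∀ z ∈ Metric.ball x₀ r, DifferentiableAt ℝ u z)
    (hK : ∀ z ∈ Metric.ball x₀ r, ‖fderiv ℝ u z‖ ≤ K * |u z|) (h0 : u x₀ = 0) :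
    ∀ z ∈ Metric.ball x₀ r, u z = 0 := by
  intro z hz
  have hr : 0 < r := lt_of_le_of_lt dist_nonneg hz
  have hmem : ∀ t ∈ Icc (0 : ℝ) 1, AffineMap.lineMap x₀ z t ∈ Metric.ball x₀ r := fun t ht =>
    (convex_ball x₀ r).segment_subset (Metric.mem_ball_self hr) hz
      (by rw [segment_eq_image_lineMap]; exact mem_image_of_mem _ ht)
  have hd : ∀ t ∈ Icc (0 : ℝ) 1, HasDerivAt (fun t => u (AffineMap.lineMap x₀ z t))
      (fderiv ℝ u (AffineMap.lineMap x₀ z t) (z - x₀)) t := fun t ht => by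
    have h1 := (hu _ (hmem t ht)).hasFDerivAt
    have h2 : HasDerivAt (fun t : ℝ => AffineMap.lineMap x₀ z t) (z - x₀) t :=
      AffineMap.hasDerivAt_lineMap
    exact h1.comp_hasDerivAt t h2
  -- Grönwall along the segment from `x₀` to `z`.
  have := eq_zero_of_abs_deriv_le_mul_abs_self_of_eq_zero_right (K := K * ‖z - x₀‖)
    (fun t ht => (hd t ht).continuousAt.continuousWithinAt)
    (fun t ht => (hd t ⟨ht.1, ht.2.le⟩).hasDerivWithinAt) (by simpa using h0)
    (fun t ht => by
      refine (ContinuousLinearMap.le_opNorm _ _).trans ?_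
      calc _ ≤ K * |u (AffineMap.lineMap x₀ z t)| * ‖z - x₀‖ := by
            gcongr; exact hK _ (hmem t ⟨ht.1, ht.2.le⟩)
        _ = _ := by rw [Real.norm_eq_abs]; ring)
    1 ⟨zero_le_one, le_rfl⟩
  simpa using this

/-- A nonnegative function whose Hessian vanishes at a critical point, and which is dominated by
the square of its gradient, vanishes near that point. -/
theorem eventually_eq_zero_of_hessian_eq_zero [InnerProductSpace ℝ E] [CompleteSpace E]
    {u : E → ℝ} {x₀ : E} {c : ℝ} (hc : 0 < c)
    (hd : ∀ᶠ z in 𝓝 x₀, DifferentiableAt ℝ u z) (h1 : fderiv ℝ u x₀ = 0)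
    (h2 : HasStrictFDerivAt (fderiv ℝ u) (0 : E →L[ℝ] E →L[ℝ] ℝ) x₀)
    (hpos : ∀ᶠ z in 𝓝 x₀, 0 ≤ u z)
    (hle : ∀ᶠ z in 𝓝 x₀, c * u z ≤ ‖fderiv ℝ u z‖ ^ 2) : ∀ᶠ z in 𝓝 x₀, u z = 0 := by
  -- A vanishing strict second derivative makes the gradient Lipschitz near `x₀` with any positive
  -- constant; c/8 is small enough for the descent step below.
  have h3 : ∀ᶠ p in 𝓝 x₀ ×ˢ 𝓝 x₀,
      ‖fderiv ℝ u p.1 - fderiv ℝ u p.2‖ ≤ c / 8 * ‖p.1 - p.2‖ := by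
    rw [← nhds_prod_eq]
    simpa using h2.isLittleO.def (show 0 < c / 8 by positivity)
  have h4 := (h3.and (((hd.and (hpos.and hle)).prod_inl (𝓝 x₀))))
  obtain ⟨r, hr, hball⟩ := (Metric.nhds_basis_ball.prod_self).mem_iff.1 h4
  have hL : ∀ y ∈ Metric.ball x₀ r, ∀ z ∈ Metric.ball x₀ r,
      ‖fderiv ℝ u y - fderiv ℝ u z‖ ≤ c / 8 * ‖y - z‖ := fun y hy z hz =>
    (hball (show (y, z) ∈ _ from ⟨hy, hz⟩)).1
  have hB : ∀ y ∈ Metric.ball x₀ r, DifferentiableAt ℝ u y ∧ 0 ≤ u y ∧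
      c * u y ≤ ‖fderiv ℝ u y‖ ^ 2 := fun y hy =>
    (hball (show (y, x₀) ∈ _ from ⟨hy, Metric.mem_ball_self hr⟩)).2
  filter_upwards [Metric.ball_mem_nhds x₀ (half_pos hr)] with y hy
  have hy' : ‖y - x₀‖ < r / 2 := by rwa [Metric.mem_ball, dist_eq_norm] at hy
  have hyr : y ∈ Metric.ball x₀ r := Metric.ball_subset_ball (by linarith) hy
  set v := (InnerProductSpace.toDual ℝ E).symm (fderiv ℝ u y) with hv
  have hvn : ‖v‖ = ‖fderiv ℝ u y‖ := LinearIsometryEquiv.norm_map _ _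
  have hvv : fderiv ℝ u y v = ‖fderiv ℝ u y‖ ^ 2 := by
    rw [← InnerProductSpace.toDual_symm_apply, ← hv, real_inner_self_eq_norm_sq, hvn]
  have hsmall : ‖fderiv ℝ u y‖ ≤ c / 8 * ‖y - x₀‖ := by
    simpa [h1] using hL y hyr x₀ (Metric.mem_ball_self hr)
  -- One gradient descent step. With G = |du(y)|², the linear term lowers u by 2G/c and the error is
  -- at most (c/8)|w|² = G/(2c). As u(y + w) ≥ 0, this gives c·u(y) ≥ 3G/2 ≥ (3/2)c·u(y), so u(y) =
  -- 0. The factor 1/4 in |w| ≤ |y − x₀|/4 keeps y + w in the ball.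
  set w : E := -(2 / c) • v with hw
  have hwn : ‖w‖ = 2 / c * ‖fderiv ℝ u y‖ := by
    rw [hw, norm_smul, hvn, norm_neg, Real.norm_of_nonneg (by positivity)]
  have hwr : ‖w‖ < r / 2 := by
    have : 2 / c * ‖fderiv ℝ u y‖ ≤ 2 / c * (c / 8 * ‖y - x₀‖) := by gcongr
    have e : 2 / c * (c / 8 * ‖y - x₀‖) = ‖y - x₀‖ / 4 := by field_simp; ring
    rw [hwn]; linarith [norm_nonneg (y - x₀)]
  have hyw : y + w ∈ Metric.ball x₀ r := by
    rw [Metric.mem_ball, dist_eq_norm]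
    calc ‖y + w - x₀‖ = ‖(y - x₀) + w‖ := by congr 1; abel
      _ ≤ ‖y - x₀‖ + ‖w‖ := norm_add_le _ _
      _ < r := by linarith
  have hmv := ((convex_ball x₀ r).inter (convex_closedBall y ‖w‖)).norm_image_sub_le_of_norm_fderiv_le'
    (f := u) (φ := fderiv ℝ u y) (C := c / 8 * ‖w‖) (x := y) (y := y + w)
    (fun z hz => (hB z hz.1).1) (fun z hz => (hL z hz.1 y hyr).trans (by
      have := hz.2
      rw [mem_closedBall_iff_norm] at this
      gcongr)) ⟨hyr, by simp⟩ ⟨hyw, by simp⟩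
  rw [add_sub_cancel_left] at hmv
  have h5 := le_of_abs_le hmv
  have h6 : fderiv ℝ u y w = -(2 / c) * ‖fderiv ℝ u y‖ ^ 2 := by
    rw [hw, map_smul, hvv, smul_eq_mul]
  rw [h6, mul_assoc, hwn] at h5
  have h7 := (hB _ hyw).2.1
  have h8 := (hB y hyr).2
  have h9 : c / 8 * (2 / c * ‖fderiv ℝ u y‖ * (2 / c * ‖fderiv ℝ u y‖)) =
      1 / (2 * c) * ‖fderiv ℝ u y‖ ^ 2 := by field_simp; norm_num
  rw [h9] at h5
  set G := ‖fderiv ℝ u y‖ ^ 2 with hG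
  have hG0 : 0 ≤ G := by positivity
  have e1 : c * (-(2 / c) * G) = -(2 * G) := by field_simp
  have e2 : c * (1 / (2 * c) * G) = G / 2 := by field_simp
  have h10 : c * (0 - u y - -(2 / c) * G) ≤ c * (1 / (2 * c) * G) := by
    apply mul_le_mul_of_nonneg_left _ hc.le
    linarith
  have h11 : c * u y ≥ 0 := mul_nonneg hc.le h8.1
  have h12 : c * u y = 0 := by nlinarith
  exact (mul_eq_zero.1 h12).resolve_left hc.ne'

end

/-! ### Metric, gradient and volume density in a chart -/

section

variable {n : ℕ} {M : Type*} [TopologicalSpace M]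
  [ChartedSpace (EuclideanSpace ℝ (Fin n)) M] [IsManifold (𝓡 n) ∞ M]

/-- The derivative of the inverse of the chart at `p`. -/
def chartSymmDeriv (p : M) (z : EuclideanSpace ℝ (Fin n)) :
    EuclideanSpace ℝ (Fin n) →L[ℝ] TangentSpace (𝓡 n) ((extChartAt (𝓡 n) p).symm z) :=
  mfderiv 𝓘(ℝ, EuclideanSpace ℝ (Fin n)) (𝓡 n) (extChartAt (𝓡 n) p).symm z

/-- The derivative of the chart at `p`. -/
def chartDeriv (p : M) (z : EuclideanSpace ℝ (Fin n)) :
    TangentSpace (𝓡 n) ((extChartAt (𝓡 n) p).symm z) →L[ℝ] EuclideanSpace ℝ (Fin n) :=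
  mfderiv (𝓡 n) 𝓘(ℝ, EuclideanSpace ℝ (Fin n)) (extChartAt (𝓡 n) p) ((extChartAt (𝓡 n) p).symm z)

/-- The metric in the chart at `p`. -/
def chartForm (g : Metric n M) (p : M) (z : EuclideanSpace ℝ (Fin n)) :
    EuclideanSpace ℝ (Fin n) →L[ℝ] EuclideanSpace ℝ (Fin n) →L[ℝ] ℝ :=
  (ContinuousLinearMap.precomp ℝ (chartSymmDeriv p z)).comp
    ((g.inner ((extChartAt (𝓡 n) p).symm z)).comp (chartSymmDeriv p z))

/-- A function in the chart at `p`. -/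
def chartRep (p : M) (f : M → ℝ) (z : EuclideanSpace ℝ (Fin n)) : ℝ :=
  f ((extChartAt (𝓡 n) p).symm z)

theorem chartForm_apply (g : Metric n M) (p : M) (z v w : EuclideanSpace ℝ (Fin n)) :
    chartForm g p z v w =
      g.inner ((extChartAt (𝓡 n) p).symm z) (chartSymmDeriv p z v) (chartSymmDeriv p z w) := rfl

theorem chartForm_symm (g : Metric n M) (p : M) (z v w : EuclideanSpace ℝ (Fin n)) :
    chartForm g p z v w = chartForm g p z w v := g.symm _ _ _

theorem gram_eq (g : Metric n M) (p : M) (z : EuclideanSpace ℝ (Fin n)) (i j : Fin n) :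
    gram g p z i j =
      chartForm g p z (EuclideanSpace.single i 1) (EuclideanSpace.single j 1) := rfl

theorem chartSymmDeriv_chartDeriv {p : M} {z : EuclideanSpace ℝ (Fin n)}
    (hz : z ∈ (extChartAt (𝓡 n) p).target)
    (v : TangentSpace (𝓡 n) ((extChartAt (𝓡 n) p).symm z)) :
    chartSymmDeriv p z (chartDeriv p z v) = v := by
  have := mfderivWithin_extChartAt_symm_comp_mfderiv_extChartAt hz
  rw [ModelWithCorners.Boundaryless.range_eq_univ, mfderivWithin_univ] at this
  exact DFunLike.congr_fun this v

theorem chartDeriv_chartSymmDeriv {p : M} {z : EuclideanSpace ℝ (Fin n)}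
    (hz : z ∈ (extChartAt (𝓡 n) p).target) (v : EuclideanSpace ℝ (Fin n)) :
    chartDeriv p z (chartSymmDeriv p z v) = v := by
  have := mfderiv_extChartAt_comp_mfderivWithin_extChartAt_symm hz
  rw [ModelWithCorners.Boundaryless.range_eq_univ, mfderivWithin_univ] at this
  exact DFunLike.congr_fun this v

/-- Links charts to the bundle trivialization, in terms of which the smoothness of the metric is
available. -/
theorem chartSymmDeriv_eq_symmL {p : M} {z : EuclideanSpace ℝ (Fin n)}
    (hz : z ∈ (extChartAt (𝓡 n) p).target) :
    chartSymmDeriv p z = (trivializationAt (EuclideanSpace ℝ (Fin n)) (TangentSpace (𝓡 n)) p).symmL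
      ℝ ((extChartAt (𝓡 n) p).symm z) := by
  have h1 : (extChartAt (𝓡 n) p).symm z ∈ (chartAt (EuclideanSpace ℝ (Fin n)) p).source := by
    rw [← extChartAt_source (𝓡 n)]; exact (extChartAt (𝓡 n) p).map_target hz
  rw [TangentBundle.symmL_trivializationAt h1, ModelWithCorners.Boundaryless.range_eq_univ,
    mfderivWithin_univ, (extChartAt (𝓡 n) p).right_inv hz]
  rfl

theorem chartForm_pos (g : Metric n M) {p : M} {z : EuclideanSpace ℝ (Fin n)}
    (hz : z ∈ (extChartAt (𝓡 n) p).target) {v : EuclideanSpace ℝ (Fin n)} (hv : v ≠ 0) :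
    0 < chartForm g p z v v := by
  refine g.pos _ _ fun h => hv ?_
  have h' : chartSymmDeriv p z v = 0 := h
  rw [← chartDeriv_chartSymmDeriv hz v, h', map_zero]

theorem contMDiffOn_inner_symmL (g : Metric n M) (p : M) (v w : EuclideanSpace ℝ (Fin n)) :
    ContMDiffOn (𝓡 n) 𝓘(ℝ, ℝ) ∞ (fun m : M => g.inner m
      ((trivializationAt (EuclideanSpace ℝ (Fin n)) (TangentSpace (𝓡 n)) p).symmL ℝ m v)
      ((trivializationAt (EuclideanSpace ℝ (Fin n)) (TangentSpace (𝓡 n)) p).symmL ℝ m w))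
      (trivializationAt (EuclideanSpace ℝ (Fin n)) (TangentSpace (𝓡 n)) p).baseSet := by
  set e := trivializationAt (EuclideanSpace ℝ (Fin n)) (TangentSpace (𝓡 n) (M := M)) p
  have hsec : ∀ v : EuclideanSpace ℝ (Fin n), ContMDiffOn (𝓡 n)
      ((𝓡 n).prod 𝓘(ℝ, EuclideanSpace ℝ (Fin n))) ∞
      (fun m : M => TotalSpace.mk' (EuclideanSpace ℝ (Fin n)) m (e.symmL ℝ m v)) e.baseSet := by
    intro v
    have h1 := e.contMDiffOn_symm (n := ∞) (IB := 𝓡 n)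
    have h2 : ContMDiffOn (𝓡 n) ((𝓡 n).prod 𝓘(ℝ, EuclideanSpace ℝ (Fin n))) ∞
        (fun m : M => (m, v)) e.baseSet := contMDiffOn_id.prodMk contMDiffOn_const
    refine (h1.comp h2 fun m hm => e.mem_target.2 hm).congr fun m hm => ?_
    simp only [Function.comp_def]
    rw [e.symmL_apply hm]
    exact e.mk_symm hm v
  intro x hx
  have := ContMDiffWithinAt.clm_bundle_apply₂ (E₃ := Bundle.Trivial M ℝ) (F₃ := ℝ)
    (g.contMDiff.contMDiffAt.contMDiffWithinAt (s := e.baseSet) (x := x)) (hsec v x hx) (hsec w x hx)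
  simp only [contMDiffWithinAt_totalSpace] at this
  exact this.2

theorem contDiffOn_chartForm (g : Metric n M) (p : M) :
    ContDiffOn ℝ ∞ (chartForm g p) (extChartAt (𝓡 n) p).target := by
  rw [contDiffOn_clm_apply]
  intro v
  rw [contDiffOn_clm_apply]
  intro w
  rw [← contMDiffOn_iff_contDiffOn]
  refine ((contMDiffOn_inner_symmL g p v w).comp (contMDiffOn_extChartAt_symm p) ?_).congr ?_
  · intro z hz
    have := (extChartAt (𝓡 n) p).map_target hz
    rw [extChartAt_source] at this
    simpa using this
  · intro z hz
    rw [chartForm_apply, chartSymmDeriv_eq_symmL hz]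
    rfl

theorem contDiffOn_chartRep {f : M → ℝ} (hf : ContMDiff (𝓡 n) 𝓘(ℝ, ℝ) ∞ f) (p : M) :
    ContDiffOn ℝ ∞ (chartRep p f) (extChartAt (𝓡 n) p).target := by
  rw [← contMDiffOn_iff_contDiffOn]
  exact hf.comp_contMDiffOn (contMDiffOn_extChartAt_symm p)

theorem mfderiv_chartSymmDeriv {f : M → ℝ} (hf : ContMDiff (𝓡 n) 𝓘(ℝ, ℝ) ∞ f) {p : M}
    {z : EuclideanSpace ℝ (Fin n)} (hz : z ∈ (extChartAt (𝓡 n) p).target)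
    (v : EuclideanSpace ℝ (Fin n)) :
    mfderiv (𝓡 n) 𝓘(ℝ, ℝ) f ((extChartAt (𝓡 n) p).symm z) (chartSymmDeriv p z v) =
      fderiv ℝ (chartRep p f) z v := by
  have h1 : MDifferentiableAt 𝓘(ℝ, EuclideanSpace ℝ (Fin n)) (𝓡 n) (extChartAt (𝓡 n) p).symm z :=
    by
      have := mdifferentiableWithinAt_extChartAt_symm hz
      rwa [ModelWithCorners.Boundaryless.range_eq_univ, mdifferentiableWithinAt_univ] at this
  have h2 : MDifferentiableAt (𝓡 n) 𝓘(ℝ, ℝ) f ((extChartAt (𝓡 n) p).symm z) :=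
    hf.mdifferentiable (by simp) _
  have h3 := mfderiv_comp z h2 h1
  rw [mfderiv_eq_fderiv] at h3
  exact (DFunLike.congr_fun h3 v).symm

theorem chartForm_coords_gradient (g : Metric n M) {f : M → ℝ}
    (hf : ContMDiff (𝓡 n) 𝓘(ℝ, ℝ) ∞ f) {p : M}
    {z : EuclideanSpace ℝ (Fin n)} (hz : z ∈ (extChartAt (𝓡 n) p).target) :
    chartForm g p z (coords p (gradient g f) z) = fderiv ℝ (chartRep p f) z := by
  ext v
  rw [chartForm_apply, ← mfderiv_chartSymmDeriv hf hz, ← inner_gradient g f]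
  congr 2
  exact chartSymmDeriv_chartDeriv hz _

theorem gradientNormSq_eq (g : Metric n M) {f : M → ℝ}
    (hf : ContMDiff (𝓡 n) 𝓘(ℝ, ℝ) ∞ f) {p : M}
    {z : EuclideanSpace ℝ (Fin n)} (hz : z ∈ (extChartAt (𝓡 n) p).target) :
    gradientNormSq g f ((extChartAt (𝓡 n) p).symm z) =
      fderiv ℝ (chartRep p f) z (coords p (gradient g f) z) := by
  rw [← chartForm_coords_gradient g hf hz, chartForm_apply]
  have := chartSymmDeriv_chartDeriv hz (gradient g f ((extChartAt (𝓡 n) p).symm z))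
  change _ = g.inner _ (chartSymmDeriv p z (chartDeriv p z _))
    (chartSymmDeriv p z (chartDeriv p z _))
  rw [this]
  rfl

/-- Positivity gives injectivity, and the space and its dual have equal dimension. -/
theorem isInvertible_chartForm (g : Metric n M) {p : M} {z : EuclideanSpace ℝ (Fin n)}
    (hz : z ∈ (extChartAt (𝓡 n) p).target) : (chartForm g p z).IsInvertible := by
  have hinj : Function.Injective (chartForm g p z).toLinearMap := by
    rw [injective_iff_map_eq_zero]
    intro v hv
    by_contra hne
    have := chartForm_pos g hz hne
    have h0 : chartForm g p z v = 0 := hv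
    rw [h0] at this
    exact lt_irrefl _ this
  have hfr : Module.finrank ℝ (EuclideanSpace ℝ (Fin n)) =
      Module.finrank ℝ (EuclideanSpace ℝ (Fin n) →L[ℝ] ℝ) :=
    (InnerProductSpace.toDual ℝ (EuclideanSpace ℝ (Fin n))).toLinearEquiv.finrank_eq
  exact ⟨(LinearEquiv.ofInjectiveOfFinrankEq _ hinj hfr).toContinuousLinearEquiv, by ext; rfl⟩

/-- In coordinates the gradient is the inverse of the metric applied to the differential, and
inversion is smooth. -/
theorem contDiffOn_coords_gradient (g : Metric n M) {f : M → ℝ}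
    (hf : ContMDiff (𝓡 n) 𝓘(ℝ, ℝ) ∞ f) (p : M) :
    ContDiffOn ℝ ∞ (coords p (gradient g f)) (extChartAt (𝓡 n) p).target := by
  have hopen : IsOpen (extChartAt (𝓡 n) p).target := isOpen_extChartAt_target p
  have h1 : ContDiffOn ℝ ∞ (fun z => (chartForm g p z).inverse) (extChartAt (𝓡 n) p).target :=
    fun z hz => (isInvertible_chartForm g hz).contDiffAt_map_inverse.comp_contDiffWithinAt z
      (contDiffOn_chartForm g p z hz)
  have h2 : ContDiffOn ℝ ∞ (fderiv ℝ (chartRep p f)) (extChartAt (𝓡 n) p).target :=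
    (contDiffOn_chartRep hf p).fderiv_of_isOpen hopen (by simp)
  refine (h1.clm_apply h2).congr fun z hz => ?_
  obtain ⟨e, he⟩ := isInvertible_chartForm g hz
  rw [← chartForm_coords_gradient g hf hz, ← he, ContinuousLinearMap.inverse_equiv]
  simp

theorem det_gram_pos (g : Metric n M) {p : M} {z : EuclideanSpace ℝ (Fin n)}
    (hz : z ∈ (extChartAt (𝓡 n) p).target) : 0 < (gram g p z).det := by
  refine Matrix.PosDef.det_pos (Matrix.PosDef.of_dotProduct_mulVec_pos ?_ fun x hx => ?_)
  · ext i j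
    simp only [Matrix.conjTranspose_apply, star_trivial, gram_eq]
    exact chartForm_symm g p z _ _
  · have hv : WithLp.toLp 2 x = ∑ i, x i • EuclideanSpace.single i (1 : ℝ) := by
      ext j
      simp [Finset.sum_apply, Pi.single_apply]
    have hne : WithLp.toLp 2 x ≠ 0 := by
      intro h
      exact hx (by simpa using congrArg WithLp.ofLp h)
    have := chartForm_pos g hz hne
    rw [hv] at this
    simp only [map_sum, map_smul, sum_apply, smul_apply,
      smul_eq_mul] at this
    simp only [dotProduct, Matrix.mulVec, star_trivial, Pi.star_apply, gram_eq, Finset.mul_sum] at this ⊢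
    refine this.trans_eq (Finset.sum_comm.trans ?_)
    refine Finset.sum_congr rfl fun i _ => Finset.sum_congr rfl fun j _ => ?_
    ring

theorem contDiffOn_volumeDensity (g : Metric n M) (p : M) :
    ContDiffOn ℝ ∞ (volumeDensity g p) (extChartAt (𝓡 n) p).target := by
  have hg : ∀ i j, ContDiffOn ℝ ∞ (fun z => gram g p z i j) (extChartAt (𝓡 n) p).target := by
    intro i j
    exact ((contDiffOn_chartForm g p).clm_apply contDiffOn_const).clm_apply contDiffOn_const
  have hdet : ContDiffOn ℝ ∞ (fun z => (gram g p z).det) (extChartAt (𝓡 n) p).target := by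
    simp only [Matrix.det_apply]
    exact ContDiffOn.sum fun σ _ => (contDiffOn_prod fun i _ => hg _ _).const_smul _
  exact hdet.sqrt fun z hz => (det_gram_pos g hz).ne'

-- Compactness of the unit sphere gives a constant at `z₀`; half of it survives a perturbation of
-- norm below `c / 2`.
set_option synthInstance.maxHeartbeats 200000 in
theorem exists_eventually_coercive {E : Type*} [NormedAddCommGroup E] [NormedSpace ℝ E]
    [FiniteDimensional ℝ E] {B : E → E →L[ℝ] E →L[ℝ] ℝ} {z₀ : E} (hB : ContinuousAt B z₀)
    (hpos : ∀ v, v ≠ 0 → 0 < B z₀ v v) :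
    ∃ c > 0, ∃ A > 0, ∀ᶠ z in 𝓝 z₀, ‖B z‖ ≤ A ∧ ∀ v, c * ‖v‖ ^ 2 ≤ B z v v := by
  have hq : Continuous fun v : E => B z₀ v v := by fun_prop
  obtain ⟨c, hc, hcb'⟩ := (isCompact_sphere (0 : E) 1).exists_forall_le'
    hq.continuousOn (a := 0) fun v hv => hpos v (by rintro rfl; simp at hv)
  have hcb : ∀ v : E, c * ‖v‖ ^ 2 ≤ B z₀ v v := by
    intro v
    by_cases hv : v = 0
    · simp [hv]
    · have hn : 0 < ‖v‖ := norm_pos_iff.2 hv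
      have := hcb' (‖v‖⁻¹ • v) (by simp [norm_smul, hn.ne'])
      simp only [map_smul, smul_apply, smul_eq_mul] at this
      calc c * ‖v‖ ^ 2 ≤ (‖v‖⁻¹ * (‖v‖⁻¹ * B z₀ v v)) * ‖v‖ ^ 2 := by gcongr
        _ = _ := by field_simp
  have hev : ∀ᶠ z in 𝓝 z₀, ‖B z - B z₀‖ < c / 2 := by
    filter_upwards [hB.eventually (Metric.ball_mem_nhds (B z₀) (half_pos hc))] with z hz
    rw [← dist_eq_norm (B z) (B z₀)]
    exact hz
  refine ⟨c / 2, half_pos hc, ‖B z₀‖ + c / 2, by positivity, ?_⟩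
  filter_upwards [hev] with z hz
  refine ⟨?_, fun v => ?_⟩
  · have := norm_le_norm_add_norm_sub (B z₀) (B z)
    rw [norm_sub_rev] at this
    linarith
  · have h4 := (B z - B z₀).le_opNorm₂ v v
    have h5 := neg_le_of_abs_le (Real.norm_eq_abs _ ▸ h4)
    have h6 : ‖B z - B z₀‖ * ‖v‖ * ‖v‖ ≤ c / 2 * ‖v‖ ^ 2 := by
      rw [mul_assoc, ← sq]; gcongr
    simp only [sub_apply] at h5
    linarith [hcb v]

/-- Locally the Riemannian and Euclidean norms of the differential are comparable, so bounds in
terms of `b` become bounds on `fderiv`, to which the vanishing criteria apply. -/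
theorem exists_gradientNormSq_bounds (g : Metric n M) {f : M → ℝ}
    (hf : ContMDiff (𝓡 n) 𝓘(ℝ, ℝ) ∞ f) (p : M) :
    ∃ K > 0, ∀ᶠ z in 𝓝 (extChartAt (𝓡 n) p p),
      gradientNormSq g f ((extChartAt (𝓡 n) p).symm z) ≤ K * ‖fderiv ℝ (chartRep p f) z‖ ^ 2 ∧
      ‖fderiv ℝ (chartRep p f) z‖ ^ 2 ≤ K * gradientNormSq g f ((extChartAt (𝓡 n) p).symm z) := by
  have hopen : IsOpen (extChartAt (𝓡 n) p).target := isOpen_extChartAt_target p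
  set z₀ := extChartAt (𝓡 n) p p with hz₀
  have hz₀t : z₀ ∈ (extChartAt (𝓡 n) p).target := mem_extChartAt_target p
  have hcont : ContinuousAt (chartForm g p) z₀ :=
    (contDiffOn_chartForm g p).continuousOn.continuousAt (hopen.mem_nhds hz₀t)
  obtain ⟨c, hc, A, hA0, hev⟩ := exists_eventually_coercive hcont
    fun v hv => chartForm_pos g hz₀t hv
  refine ⟨max (1 / c) (A ^ 2 * (1 / c)), by positivity, ?_⟩
  filter_upwards [hev, hopen.mem_nhds hz₀t] with z ⟨h1, h2⟩ hz
  set X := coords p (gradient g f) z with hX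
  have hlow : c * ‖X‖ ^ 2 ≤ chartForm g p z X X := h2 X
  have hform := chartForm_coords_gradient g hf hz
  have hN := gradientNormSq_eq g hf hz
  rw [← hX] at hform hN
  rw [← hform] at hN ⊢
  set G := gradientNormSq g f ((extChartAt (𝓡 n) p).symm z) with hG
  set D := ‖chartForm g p z X‖ with hD
  have hGD : G ≤ D * ‖X‖ := hN ▸ (le_abs_self _).trans ((chartForm g p z X).le_opNorm X)
  have hDA : D ≤ A * ‖X‖ := ((chartForm g p z).le_opNorm X).trans (by gcongr)
  rw [← hN] at hlow
  have hX2 : ‖X‖ ^ 2 ≤ 1 / c * G := by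
    rw [div_mul_eq_mul_div, le_div_iff₀ hc]; linarith
  have hD0 : 0 ≤ D := norm_nonneg _
  have hG0 : 0 ≤ G := le_trans (by positivity) hlow
  constructor
  · have h7 : G ≤ 1 / c * D ^ 2 := by
      by_cases hX0 : ‖X‖ = 0
      · rw [hX0, mul_zero] at hGD
        exact hGD.trans (by positivity)
      · have hXp : 0 < ‖X‖ := lt_of_le_of_ne (norm_nonneg _) (Ne.symm hX0)
        have h8 : c * ‖X‖ ≤ D := by
          have : c * ‖X‖ * ‖X‖ ≤ D * ‖X‖ := by
            rw [mul_assoc, ← sq]; linarith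
          exact le_of_mul_le_mul_right this hXp
        have h9 : ‖X‖ ≤ 1 / c * D := by
          rw [div_mul_eq_mul_div, le_div_iff₀ hc]; linarith
        calc G ≤ D * ‖X‖ := hGD
          _ ≤ D * (1 / c * D) := by gcongr
          _ = _ := by ring
    exact h7.trans (by gcongr; exact le_max_left _ _)
  · calc D ^ 2 ≤ (A * ‖X‖) ^ 2 := by gcongr
      _ = A ^ 2 * ‖X‖ ^ 2 := by ring
      _ ≤ A ^ 2 * (1 / c * G) := by gcongr
      _ = A ^ 2 * (1 / c) * G := by ring
      _ ≤ _ := by gcongr; exact le_max_right _ _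

end

/-! ### Critical levels: the zeros of b are simple, extremal and without interior -/

/-- A `C²` function on an interval with a double zero at `c` is at most quadratic near `c`. -/
theorem exists_le_sq_of_derivWithin_eq_zero {b : ℝ → ℝ} {α β c : ℝ} (hαβ : α < β)
    (hb : ContDiffOn ℝ ∞ b (Icc α β)) (hc : c ∈ Icc α β) (h0 : b c = 0)
    (h1 : derivWithin b (Icc α β) c = 0) :
    ∃ K, 0 ≤ K ∧ ∀ t ∈ Icc α β, b t ≤ K * (t - c) ^ 2 := by
  obtain ⟨hd, hb'⟩ := (contDiffOn_infty_iff_derivWithin (uniqueDiffOn_Icc hαβ)).1 hb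
  obtain ⟨hd', hb''⟩ := (contDiffOn_infty_iff_derivWithin (uniqueDiffOn_Icc hαβ)).1 hb'
  obtain ⟨K, hK⟩ := isCompact_Icc.exists_bound_of_continuousOn hb''.continuousOn
  have hK0 : 0 ≤ K := (norm_nonneg _).trans (hK c hc)
  refine ⟨K, hK0, fun t ht => ?_⟩
  have hsub : uIcc c t ⊆ Icc α β := uIcc_subset_Icc hc ht
  have h2 := Convex.norm_image_sub_le_of_norm_hasDerivWithin_le (s := uIcc c t) (f := b)
    (f' := derivWithin b (Icc α β)) (C := K * |t - c|)
    (fun x hx => (hd x (hsub hx)).hasDerivWithinAt.mono hsub)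
    (fun x hx => by
      have := Convex.norm_image_sub_le_of_norm_derivWithin_le hd' hK (convex_Icc α β) hc (hsub hx)
      rw [h1, sub_zero] at this
      refine this.trans ?_
      gcongr
      rw [Real.norm_eq_abs]
      exact abs_sub_left_of_mem_uIcc hx)
    (convex_uIcc c t) left_mem_uIcc right_mem_uIcc
  rw [h0, sub_zero, Real.norm_eq_abs, Real.norm_eq_abs, mul_assoc, ← sq, sq_abs] at h2
  exact (le_abs_self _).trans h2

/-- A nonnegative function with a simple zero at `c` grows at least linearly near `c`. -/
theorem exists_mul_abs_le_of_derivWithin_ne_zero {b : ℝ → ℝ} {s : Set ℝ} {c : ℝ}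
    (hb : ∀ t ∈ s, 0 ≤ b t) (h0 : b c = 0) (h1 : derivWithin b s c ≠ 0) :
    ∃ κ > 0, ∀ᶠ t in 𝓝[s] c, κ * |t - c| ≤ b t := by
  have hd : HasDerivWithinAt b (derivWithin b s c) s c :=
    (differentiableWithinAt_of_derivWithin_ne_zero h1).hasDerivWithinAt
  have hpos : 0 < |derivWithin b s c| := abs_pos.2 h1
  refine ⟨|derivWithin b s c| / 2, half_pos hpos, ?_⟩
  filter_upwards [(hasDerivWithinAt_iff_isLittleO.1 hd).def (half_pos hpos),
    self_mem_nhdsWithin] with t ht hts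
  rw [h0, sub_zero, Real.norm_eq_abs, Real.norm_eq_abs, smul_eq_mul] at ht
  have h3 := abs_sub_abs_le_abs_sub ((t - c) * derivWithin b s c) (b t)
  rw [abs_sub_comm ((t - c) * derivWithin b s c), abs_mul, abs_of_nonneg (hb t hts)] at h3
  nlinarith

section

variable {n : ℕ} {M : Type*} [TopologicalSpace M]
  [ChartedSpace (EuclideanSpace ℝ (Fin n)) M]

theorem eventually_nhds_of_chart {p : M} {P : M → Prop}
    (h : ∀ᶠ z in 𝓝 (extChartAt (𝓡 n) p p), P ((extChartAt (𝓡 n) p).symm z)) :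
    ∀ᶠ y in 𝓝 p, P y := by
  filter_upwards [(continuousAt_extChartAt p).eventually h,
    extChartAt_source_mem_nhds (I := 𝓡 n) p] with y hy hys
  rwa [(extChartAt (𝓡 n) p).left_inv hys] at hy

theorem eventually_chart_of_nhds {p : M} {P : M → Prop} (h : ∀ᶠ y in 𝓝 p, P y) :
    ∀ᶠ z in 𝓝 (extChartAt (𝓡 n) p p), P ((extChartAt (𝓡 n) p).symm z) := by
  refine (continuousAt_extChartAt_symm p).eventually ?_
  rwa [extChartAt_to_inv]

theorem chartRep_self (p : M) (f : M → ℝ) : chartRep p f (extChartAt (𝓡 n) p p) = f p := by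
  simp [chartRep]

variable [IsManifold (𝓡 n) ∞ M]

theorem chartRep_contDiffAt {f : M → ℝ} (hf : ContMDiff (𝓡 n) 𝓘(ℝ, ℝ) ∞ f) (p : M) :
    ∀ᶠ z in 𝓝 (extChartAt (𝓡 n) p p), ContDiffAt ℝ ∞ (chartRep p f) z := by
  have hopen : IsOpen (extChartAt (𝓡 n) p).target := isOpen_extChartAt_target p
  filter_upwards [hopen.mem_nhds (mem_extChartAt_target p)] with z hz
  exact (contDiffOn_chartRep hf p).contDiffAt (hopen.mem_nhds hz)

theorem gradientNormSq_nonneg (g : Metric n M) (f : M → ℝ) (x : M) : 0 ≤ gradientNormSq g f x := by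
  by_cases h : gradient g f x = 0
  · simp [gradientNormSq, h]
  · exact (g.pos x _ h).le

theorem gradientNormSq_eq_zero_iff (g : Metric n M) {f : M → ℝ}
    (hf : ContMDiff (𝓡 n) 𝓘(ℝ, ℝ) ∞ f) (p : M) :
    gradientNormSq g f p = 0 ↔ fderiv ℝ (chartRep p f) (extChartAt (𝓡 n) p p) = 0 := by
  obtain ⟨K, hK, h⟩ := exists_gradientNormSq_bounds g hf p
  obtain ⟨h1, h2⟩ := h.self_of_nhds
  rw [extChartAt_to_inv] at h1 h2
  constructor
  · intro h0
    rw [h0, mul_zero] at h2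
    exact norm_eq_zero.1 (by nlinarith [norm_nonneg (fderiv ℝ (chartRep p f) (extChartAt (𝓡 n) p p))])
  · intro h0
    rw [h0, norm_zero] at h1
    exact le_antisymm (by simpa using h1) (gradientNormSq_nonneg g f p)

/-- The flow of the gradient takes infinite time to reach a level on which `b` has a double zero,
so that such a level is the whole manifold. -/
theorem eq_const_of_quadratic [ConnectedSpace M] (g : Metric n M) {f : M → ℝ} {b : ℝ → ℝ} {c K : ℝ}
    (hf : ContMDiff (𝓡 n) 𝓘(ℝ, ℝ) ∞ f) (hb : ∀ x, gradientNormSq g f x = b (f x))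
    (hK0 : 0 ≤ K) (hK : ∀ t ∈ range f, b t ≤ K * (t - c) ^ 2) (hc : c ∈ range f) :
    ∀ x, f x = c := by
  have hclosed : IsClosed {x | f x = c} := isClosed_eq hf.continuous continuous_const
  have hopen : IsOpen {x | f x = c} := by
    refine isOpen_iff_mem_nhds.2 fun p (hp : f p = c) => eventually_nhds_of_chart (n := n) ?_
    obtain ⟨K', hK', hev⟩ := exists_gradientNormSq_bounds g hf p
    obtain ⟨r, hr, hball⟩ := Metric.nhds_basis_ball.mem_iff.1 (hev.and (chartRep_contDiffAt hf p))
    -- The constant comes from |df|² ≤ K'·b(f) ≤ K'K·(f − c)².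
    have key := eq_zero_of_norm_fderiv_le (u := fun z => chartRep p f z - c)
      (x₀ := extChartAt (𝓡 n) p p) (r := r) (K := Real.sqrt (K' * K))
      (fun z hz => ((hball hz).2.differentiableAt (by simp)).sub_const c)
      (fun z hz => by
        rw [fderiv_sub_const]
        have h1 := (hball hz).1.2
        rw [hb] at h1
        have h2 := hK _ (mem_range_self ((extChartAt (𝓡 n) p).symm z))
        refine abs_le_of_sq_le_sq' ?_ (by positivity) |>.2
        rw [mul_pow, Real.sq_sqrt (by positivity), sq_abs, mul_assoc]
        exact h1.trans (by gcongr; exact h2))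
      (by rw [chartRep_self, hp, sub_self])
    filter_upwards [Metric.ball_mem_nhds _ hr] with z hz
    exact sub_eq_zero.1 (key z hz)
  have := IsClopen.eq_univ ⟨hclosed, hopen⟩ hc
  exact fun x => this.ge (mem_univ x)

theorem exists_range_eq_Icc [CompactSpace M] [ConnectedSpace M] {f : M → ℝ} (hf : Continuous f)
    (hne : ∃ x y, f x ≠ f y) : ∃ α β, α < β ∧ range f = Icc α β := by
  have h := eq_Icc_of_connected_compact (isConnected_range hf) (isCompact_range hf)
  refine ⟨_, _, ?_, h⟩
  by_contra hle
  obtain ⟨x, y, hxy⟩ := hne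
  have hx := h ▸ mem_range_self (f := f) x
  have hy := h ▸ mem_range_self (f := f) y
  exact hxy (by linarith [hx.1, hx.2, hy.1, hy.2, not_lt.1 hle])

/-- The zeros of `b` are simple and extremal. -/
theorem derivWithin_ne_zero_of_zero [CompactSpace M] [ConnectedSpace M] (g : Metric n M)
    {f : M → ℝ} {b : ℝ → ℝ} {c : ℝ} (hf : ContMDiff (𝓡 n) 𝓘(ℝ, ℝ) ∞ f)
    (hne : ∃ x y, f x ≠ f y) (hb : ∀ x, gradientNormSq g f x = b (f x))
    (hbs : ContDiffOn ℝ ∞ b (range f)) (hc : c ∈ range f) (h0 : b c = 0) :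
    derivWithin b (range f) c ≠ 0 ∧ ((∀ x, c ≤ f x) ∨ ∀ x, f x ≤ c) := by
  obtain ⟨α, β, hαβ, hr⟩ := exists_range_eq_Icc hf.continuous hne
  have hbpos : ∀ t ∈ range f, 0 ≤ b t := by
    rintro _ ⟨x, rfl⟩
    rw [← hb]; exact gradientNormSq_nonneg g f x
  have h1 : derivWithin b (range f) c ≠ 0 := by
    intro h1
    rw [hr] at hbs hc h1
    obtain ⟨K, hK0, hK⟩ := exists_le_sq_of_derivWithin_eq_zero hαβ hbs hc h0 h1
    have := eq_const_of_quadratic g hf hb hK0 (hr ▸ hK) (hr ▸ hc)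
    obtain ⟨x, y, hxy⟩ := hne
    exact hxy ((this x).trans (this y).symm)
  refine ⟨h1, ?_⟩
  by_contra hcon
  push Not at hcon
  obtain ⟨⟨x, hx⟩, ⟨y, hy⟩⟩ := hcon
  have hx' := hr ▸ mem_range_self (f := f) x
  have hy' := hr ▸ mem_range_self (f := f) y
  have hn : range f ∈ 𝓝 c := by
    rw [hr]; exact Icc_mem_nhds (hx'.1.trans_lt hx) (hy.trans_le hy'.2)
  -- An interior zero of the nonnegative function `b` would be a minimum, hence not simple.
  have hmin : IsLocalMin b c := by
    filter_upwards [hn] with t ht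
    rw [h0]; exact hbpos t ht
  rw [derivWithin_of_mem_nhds hn] at h1
  exact h1 hmin.deriv_eq_zero

/-- A simple zero of b gives κ|f − f(p)| ≤ b(f) ≤ K|df|² near p. Since f(p) is extremal, |f − f(p)|
is smooth, being f − f(p) up to a fixed sign, and the Hessian criterion applies to it. -/
theorem eventually_eq_of_hessian_eq_zero (g : Metric n M)
    {f : M → ℝ} {b : ℝ → ℝ} {κ : ℝ} (hf : ContMDiff (𝓡 n) 𝓘(ℝ, ℝ) ∞ f)
    (hb : ∀ x, gradientNormSq g f x = b (f x)) {p : M} (h0 : b (f p) = 0) (hκ : 0 < κ)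
    (hle : ∀ᶠ t in 𝓝[range f] (f p), κ * |t - f p| ≤ b t)
    (hext : (∀ x, f p ≤ f x) ∨ ∀ x, f x ≤ f p)
    (hhess : fderiv ℝ (fderiv ℝ (chartRep p f)) (extChartAt (𝓡 n) p p) = 0) :
    ∀ᶠ x in 𝓝 p, f x = f p := by
  set z₀ := extChartAt (𝓡 n) p p with hz₀
  obtain ⟨σ, hσ, hσf⟩ : ∃ σ : ℝ, |σ| = 1 ∧ ∀ x, 0 ≤ σ * (f x - f p) := by
    rcases hext with h | h
    · exact ⟨1, by simp, fun x => by linarith [h x]⟩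
    · exact ⟨-1, by simp, fun x => by linarith [h x]⟩
  have hσ0 : σ ≠ 0 := by rintro rfl; simp at hσ
  obtain ⟨K, hK, hev⟩ := exists_gradientNormSq_bounds g hf p
  have hcd := chartRep_contDiffAt hf p
  set u := fun z : EuclideanSpace ℝ (Fin n) => σ * (chartRep p f z - f p) with hu
  have hfd : ∀ᶠ z in 𝓝 z₀, fderiv ℝ u z = σ • fderiv ℝ (chartRep p f) z := by
    filter_upwards [hcd] with z hz
    rw [hu, fderiv_const_mul ((hz.differentiableAt (by simp)).sub_const _), fderiv_sub_const]
  have h1 : fderiv ℝ u z₀ = 0 := by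
    rw [hfd.self_of_nhds, (gradientNormSq_eq_zero_iff g hf p).1 (by rw [hb, h0]), smul_zero]
  have h2 : HasStrictFDerivAt (fderiv ℝ u) (0 : EuclideanSpace ℝ (Fin n) →L[ℝ]
      EuclideanSpace ℝ (Fin n) →L[ℝ] ℝ) z₀ := by
    have h3 : ContDiffAt ℝ 1 (fderiv ℝ (chartRep p f)) z₀ :=
      hcd.self_of_nhds.fderiv_right (m := ∞) (by simp) |>.of_le (by simp)
    have h4 := (h3.hasStrictFDerivAt one_ne_zero).const_smul σ
    rw [hhess, smul_zero] at h4
    exact h4.congr_of_eventuallyEq (hfd.mono fun z hz => hz.symm)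
  have hfin : ∀ᶠ z in 𝓝 z₀, u z = 0 := by
    refine eventually_eq_zero_of_hessian_eq_zero (c := κ / K) (by positivity)
      (hcd.mono fun z hz => ((hz.differentiableAt (by simp)).sub_const _).const_mul _) h1 h2
      (Eventually.of_forall fun z => hσf _) ?_
    have hpull : ∀ᶠ z in 𝓝 z₀, κ * |chartRep p f z - f p| ≤ b (chartRep p f z) := by
      have h5 : ∀ᶠ x in 𝓝 p, κ * |f x - f p| ≤ b (f x) :=
        (tendsto_nhdsWithin_iff.2 ⟨hf.continuous.continuousAt,
          Eventually.of_forall fun x => mem_range_self x⟩).eventually hle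
      exact eventually_chart_of_nhds h5
    filter_upwards [hev, hfd, hpull] with z hz hzf hzb
    rw [hzf, norm_smul, Real.norm_eq_abs, hσ, one_mul, div_mul_eq_mul_div, div_le_iff₀ hK]
    have h6 : u z ≤ |chartRep p f z - f p| := by
      refine (le_abs_self _).trans ?_
      rw [hu, abs_mul, hσ, one_mul]
    have h7 := hz.1
    rw [hb] at h7
    calc κ * u z ≤ κ * |chartRep p f z - f p| := by gcongr
      _ ≤ b (chartRep p f z) := hzb
      _ ≤ K * _ := h7
      _ = _ := mul_comm _ _
  refine eventually_nhds_of_chart (n := n) ?_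
  filter_upwards [hfin] with z hz
  exact sub_eq_zero.1 ((mul_eq_zero.1 hz).resolve_left hσ0)

/-- The level sets on which the gradient vanishes have empty interior. -/
theorem not_eventually_eq_of_zero [CompactSpace M] [ConnectedSpace M] (g : Metric n M)
    {f : M → ℝ} {b : ℝ → ℝ} (hf : ContMDiff (𝓡 n) 𝓘(ℝ, ℝ) ∞ f)
    (hne : ∃ x y, f x ≠ f y) (hb : ∀ x, gradientNormSq g f x = b (f x))
    (hbs : ContDiffOn ℝ ∞ b (range f)) {p : M} (h0 : b (f p) = 0) :
    ¬ ∀ᶠ x in 𝓝 p, f x = f p := by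
  intro hp
  have hbpos : ∀ t ∈ range f, 0 ≤ b t := by
    rintro _ ⟨x, rfl⟩
    rw [← hb]; exact gradientNormSq_nonneg g f x
  obtain ⟨hd, hext⟩ := derivWithin_ne_zero_of_zero g hf hne hb hbs (mem_range_self p) h0
  obtain ⟨κ, hκ, hle⟩ := exists_mul_abs_le_of_derivWithin_ne_zero hbpos h0 hd
  -- The points near which f is constantly `f p` form an open set. At a point of its closure the
  -- second derivative vanishes by continuity, so the Hessian criterion makes the set closed;
  -- connectedness then contradicts nonconstancy.
  have hopen : IsOpen {q | ∀ᶠ x in 𝓝 q, f x = f p} :=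
    isOpen_iff_mem_nhds.2 fun q hq => eventually_eventually_nhds.2 hq
  have hclosed : IsClosed {q | ∀ᶠ x in 𝓝 q, f x = f p} := by
    refine isClosed_of_closure_subset fun q hq => ?_
    have hfq : f q = f p := by
      have : closure {q | ∀ᶠ x in 𝓝 q, f x = f p} ⊆ {q | f q = f p} :=
        closure_minimal (fun q hq => hq.self_of_nhds)
          (isClosed_eq hf.continuous continuous_const)
      exact this hq
    have hfreq : ∃ᶠ z in 𝓝 (extChartAt (𝓡 n) q q), fderiv ℝ (fderiv ℝ (chartRep q f)) z = 0 := by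
      intro hnot
      have hcl := mem_closure_iff_frequently.1 hq
      refine hcl (eventually_nhds_of_chart (n := n) ?_)
      filter_upwards [hnot, (isOpen_extChartAt_target (I := 𝓡 n) q).mem_nhds
        (mem_extChartAt_target q)] with z hz hzt hzq
      apply hz
      have h1 : chartRep q f =ᶠ[𝓝 z] fun _ => f p :=
        (continuousAt_extChartAt_symm'' hzt).eventually hzq
      have h2 := h1.fderiv (𝕜 := ℝ)
      have h3 : fderiv ℝ (fun _ : EuclideanSpace ℝ (Fin n) => f p) = fun _ => 0 := by
        funext z; simp
      rw [h2.fderiv_eq, h3]; simp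
    have hcont : ContinuousAt (fderiv ℝ (fderiv ℝ (chartRep q f))) (extChartAt (𝓡 n) q q) := by
      have h3 : ContDiffAt ℝ 1 (fderiv ℝ (chartRep q f)) (extChartAt (𝓡 n) q q) :=
        (chartRep_contDiffAt hf q).self_of_nhds.fderiv_right (m := ∞) (by simp) |>.of_le (by simp)
      exact (h3.fderiv_right (m := 0) (by simp)).continuousAt
    have hzero : fderiv ℝ (fderiv ℝ (chartRep q f)) (extChartAt (𝓡 n) q q) = 0 := by
      by_contra hcon
      exact hfreq (hcont.eventually_ne hcon)
    rw [← hfq] at h0 hle hext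
    have := eventually_eq_of_hessian_eq_zero g hf hb h0 hκ hle hext hzero
    rw [hfq] at this
    exact this
  have huniv := IsClopen.eq_univ ⟨hclosed, hopen⟩ ⟨p, hp⟩
  obtain ⟨x, y, hxy⟩ := hne
  have hall : ∀ x, f x = f p := fun x =>
    (huniv.ge (mem_univ x) : ∀ᶠ x in 𝓝 x, f x = f p).self_of_nhds
  exact hxy ((hall x).trans (hall y).symm)

end

/-! ### Smoothness of the factor through f, and conformal change of gradient and Laplacian -/

section

variable {n : ℕ} {M : Type*} [TopologicalSpace M]
  [ChartedSpace (EuclideanSpace ℝ (Fin n)) M] [IsManifold (𝓡 n) ∞ M]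

theorem hasDerivAt_line_apply {E : Type*} [NormedAddCommGroup E] [NormedSpace ℝ E]
    {D : E → E →L[ℝ] ℝ} {D' : E →L[ℝ] E →L[ℝ] ℝ} {z : E} (hD : HasFDerivAt D D' z) (v : E) :
    HasDerivAt (fun s : ℝ => D (z + s • v) v) (D' v v) 0 := by
  have h1 : HasDerivAt (fun s : ℝ => z + s • v) v 0 := by
    simpa using ((hasDerivAt_id (0 : ℝ)).smul_const v).const_add z
  have h2 : HasFDerivAt D D' (z + (0 : ℝ) • v) := by rwa [zero_smul, add_zero]
  have h3 : HasDerivAt (fun s : ℝ => D (z + s • v)) (D' v) 0 := h2.comp_hasDerivAt (0 : ℝ) h1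
  have h4 := h3.clm_apply (hasDerivAt_const (0 : ℝ) v)
  rwa [map_zero, add_zero] at h4

/-- The restriction of a smooth function to a coordinate line, extended to a global function. -/
theorem exists_contDiff_line {f : M → ℝ} (hf : ContMDiff (𝓡 n) 𝓘(ℝ, ℝ) ∞ f) (p : M)
    (v : EuclideanSpace ℝ (Fin n)) : ∃ F : ℝ → ℝ, ContDiff ℝ ∞ F ∧
      (∀ᶠ s in 𝓝 (0 : ℝ), F s = chartRep p f (extChartAt (𝓡 n) p p + s • v)) ∧ F 0 = f p ∧
      (∀ᶠ s in 𝓝 (0 : ℝ), deriv F s =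
        fderiv ℝ (chartRep p f) (extChartAt (𝓡 n) p p + s • v) v) ∧
      deriv F 0 = fderiv ℝ (chartRep p f) (extChartAt (𝓡 n) p p) v ∧
      deriv (deriv F) 0 =
        fderiv ℝ (fderiv ℝ (chartRep p f)) (extChartAt (𝓡 n) p p) v v := by
  set z₀ := extChartAt (𝓡 n) p p with hz₀
  have hline : ContDiff ℝ ∞ fun s : ℝ => z₀ + s • v := by fun_prop
  have hopen : IsOpen ((fun s : ℝ => z₀ + s • v) ⁻¹' (extChartAt (𝓡 n) p).target) :=
    (isOpen_extChartAt_target p).preimage hline.continuous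
  have h0 : (0 : ℝ) ∈ (fun s : ℝ => z₀ + s • v) ⁻¹' (extChartAt (𝓡 n) p).target := by
    rw [mem_preimage, zero_smul, add_zero]
    exact mem_extChartAt_target p
  obtain ⟨F, hF, hFe⟩ := exists_contDiff_eventuallyEq hopen
    ((contDiffOn_chartRep hf p).comp hline.contDiffOn fun s hs => hs) h0
  have hline' : ∀ s : ℝ, HasDerivAt (fun s : ℝ => z₀ + s • v) v s := fun s => by
    simpa using ((hasDerivAt_id s).smul_const v).const_add z₀
  have hev : ∀ᶠ s in 𝓝 (0 : ℝ), ContDiffAt ℝ ∞ (chartRep p f) (z₀ + s • v) := by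
    filter_upwards [hopen.mem_nhds h0] with s hs
    exact (contDiffOn_chartRep hf p).contDiffAt ((isOpen_extChartAt_target p).mem_nhds hs)
  have hd : ∀ᶠ s in 𝓝 (0 : ℝ), deriv F s = fderiv ℝ (chartRep p f) (z₀ + s • v) v := by
    filter_upwards [hFe.eventuallyEq_nhds, hev] with s hs hs'
    rw [hs.deriv_eq]
    exact ((hs'.differentiableAt (by simp)).hasFDerivAt.comp_hasDerivAt s (hline' s)).deriv
  refine ⟨F, hF, hFe, ?_, hd, by simpa using hd.self_of_nhds, ?_⟩
  · rw [hFe.self_of_nhds]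
    simp only [Function.comp_def, zero_smul, add_zero]
    exact chartRep_self p f
  · have h1 : deriv F =ᶠ[𝓝 0] fun s => fderiv ℝ (chartRep p f) (z₀ + s • v) v := hd
    rw [h1.deriv_eq]
    have h2 : ContDiffAt ℝ 1 (fderiv ℝ (chartRep p f)) (z₀ + (0 : ℝ) • v) :=
      hev.self_of_nhds.fderiv_right (m := ∞) (by simp) |>.of_le (by simp)
    rw [zero_smul, add_zero] at h2
    exact (hasDerivAt_line_apply (h2.differentiableAt one_ne_zero).hasFDerivAt v).deriv

/-- Polarization. -/
theorem exists_diag_ne_zero {E : Type*} [NormedAddCommGroup E] [NormedSpace ℝ E]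
    {B : E →L[ℝ] E →L[ℝ] ℝ} (hsymm : ∀ v w, B v w = B w v) (hB : B ≠ 0) : ∃ v, B v v ≠ 0 := by
  by_contra hcon
  push Not at hcon
  apply hB
  ext v w
  have h1 := hcon (v + w)
  simp only [map_add, add_apply, hcon v, hcon w, hsymm w v] at h1
  simp only [zero_apply]
  linarith

/-- If a smooth function on `M` factors through an isoparametric function, then so it does
through a smooth function on the range. -/
theorem contDiffOn_range_of_comp [CompactSpace M] [ConnectedSpace M] (g : Metric n M)
    {f φ : M → ℝ} {b β : ℝ → ℝ} (hf : ContMDiff (𝓡 n) 𝓘(ℝ, ℝ) ∞ f)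
    (hne : ∃ x y, f x ≠ f y) (hb : ∀ x, gradientNormSq g f x = b (f x))
    (hbs : ContDiffOn ℝ ∞ b (range f)) (hφ : ContMDiff (𝓡 n) 𝓘(ℝ, ℝ) ∞ φ)
    (hβ : ∀ x, φ x = β (f x)) : ContDiffOn ℝ ∞ β (range f) := by
  rintro _ ⟨p, rfl⟩
  have hcomp : ∀ v : EuclideanSpace ℝ (Fin n), ∀ {F Φ : ℝ → ℝ},
      (∀ᶠ s in 𝓝 (0 : ℝ), F s = chartRep p f (extChartAt (𝓡 n) p p + s • v)) →
      (∀ᶠ s in 𝓝 (0 : ℝ), Φ s = chartRep p φ (extChartAt (𝓡 n) p p + s • v)) →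
      ∀ᶠ s in 𝓝 (0 : ℝ), Φ s = β (F s) := fun v F Φ h1 h2 => by
    filter_upwards [h1, h2] with s hs1 hs2
    rw [hs1, hs2]; exact hβ _
  by_cases h0 : b (f p) = 0
  · have hgrad := (gradientNormSq_eq_zero_iff g hf p).1 (by rw [hb, h0])
    obtain ⟨hd, hext⟩ := derivWithin_ne_zero_of_zero g hf hne hb hbs (mem_range_self p) h0
    have hbpos : ∀ t ∈ range f, 0 ≤ b t := by
      rintro _ ⟨x, rfl⟩
      rw [← hb]; exact gradientNormSq_nonneg g f x
    obtain ⟨κ, hκ, hle⟩ := exists_mul_abs_le_of_derivWithin_ne_zero hbpos h0 hd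
    have hhess : fderiv ℝ (fderiv ℝ (chartRep p f)) (extChartAt (𝓡 n) p p) ≠ 0 := fun h =>
      not_eventually_eq_of_zero g hf hne hb hbs h0
        (eventually_eq_of_hessian_eq_zero g hf hb h0 hκ hle hext h)
    have hsymm : IsSymmSndFDerivAt ℝ (chartRep p f) (extChartAt (𝓡 n) p p) :=
      (chartRep_contDiffAt hf p).self_of_nhds.isSymmSndFDerivAt (by
        rw [minSmoothness_of_isRCLikeNormedField]
        exact WithTop.coe_le_coe.2 (le_top : (2 : ℕ∞) ≤ ⊤))
    -- A direction with nonzero second derivative reduces the critical case to a fold in one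
    -- variable.
    obtain ⟨v, hv⟩ := exists_diag_ne_zero (fun v w => hsymm v w) hhess
    obtain ⟨F, hF, hFe, hF0, -, hF1, hF2⟩ := exists_contDiff_line hf p v
    obtain ⟨Φ, hΦ, hΦe, -⟩ := exists_contDiff_line hφ p v
    rw [← hF2] at hv
    rw [hgrad] at hF1
    have hF1' : deriv F 0 = 0 := by simpa using hF1
    -- This fixes the sign of F''(0): the wrong sign would make the extremum both a minimum and a
    -- maximum, so F locally constant and F''(0) = 0.
    have hconst : IsLocalMin F 0 → IsLocalMax F 0 → False := fun h1 h2 => by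
      have h3 : F =ᶠ[𝓝 0] fun _ => F 0 := by
        filter_upwards [h1, h2] with s hs1 hs2 using le_antisymm hs2 hs1
      apply hv
      have h4 := h3.deriv
      rw [h4.deriv_eq]
      simp
    rcases hext with hext | hext
    · have hmin : IsLocalMin F 0 := by
        filter_upwards [hFe] with s hs
        rw [hs, hF0]; exact hext _
      have hpos : 0 < deriv (deriv F) 0 := by
        rcases lt_or_gt_of_ne hv with h | h
        · exact (hconst hmin (isLocalMax_of_deriv_deriv_neg h hF1'
            hF.continuous.continuousAt)).elim
        · exact h
      have := contDiffWithinAt_Ici_of_comp_fold hF hΦ hF1' hpos (hcomp v hFe hΦe)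
      rw [hF0] at this
      exact this.mono (range_subset_iff.2 hext)
    · have hmax : IsLocalMax F 0 := by
        filter_upwards [hFe] with s hs
        rw [hs, hF0]; exact hext _
      have hneg : deriv (deriv F) 0 < 0 := by
        rcases lt_or_gt_of_ne hv with h | h
        · exact h
        · exact (hconst (isLocalMin_of_deriv_deriv_pos h hF1' hF.continuous.continuousAt)
            hmax).elim
      have := contDiffWithinAt_Iic_of_comp_fold hF hΦ hF1' hneg (hcomp v hFe hΦe)
      rw [hF0] at this
      exact this.mono (range_subset_iff.2 hext)
  · have hgrad : fderiv ℝ (chartRep p f) (extChartAt (𝓡 n) p p) ≠ 0 := fun h =>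
      h0 (by rw [← hb, (gradientNormSq_eq_zero_iff g hf p).2 h])
    obtain ⟨v, hv⟩ : ∃ v, fderiv ℝ (chartRep p f) (extChartAt (𝓡 n) p p) v ≠ 0 := by
      by_contra hcon
      push Not at hcon
      exact hgrad (ContinuousLinearMap.ext hcon)
    obtain ⟨F, hF, hFe, hF0, -, hF1, -⟩ := exists_contDiff_line hf p v
    obtain ⟨Φ, hΦ, hΦe, -⟩ := exists_contDiff_line hφ p v
    have := (contDiffAt_of_comp_regular hF hΦ (by rwa [hF1]) (hcomp v hFe hΦe)).1
    rw [hF0] at this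
    exact this.contDiffWithinAt

theorem gradient_conformal {g h : Metric n M} {φ : M → ℝ} (hφ : IsConformalFactor g h φ)
    (f : M → ℝ) (x : M) : gradient h f x = (φ x)⁻¹ • gradient g f x := by
  have key : ∀ w, h.inner x (gradient h f x - (φ x)⁻¹ • gradient g f x) w = 0 := fun w => by
    have h1 := hφ.eq x ((φ x)⁻¹ • gradient g f x) w
    rw [map_smul, smul_apply, smul_eq_mul, map_smul, smul_apply, smul_eq_mul,
      mul_inv_cancel_left₀ (hφ.pos x).ne', inner_gradient] at h1
    rw [map_sub, sub_apply, inner_gradient, map_smul, smul_apply, smul_eq_mul, h1]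
    exact sub_self (G := ℝ) _
  rw [← sub_eq_zero]
  by_contra hne
  exact (h.pos x _ hne).ne' (key _)

theorem gradientNormSq_conformal {g h : Metric n M} {φ : M → ℝ} (hφ : IsConformalFactor g h φ)
    (f : M → ℝ) (x : M) : gradientNormSq h f x = (φ x)⁻¹ * gradientNormSq g f x := by
  have := (hφ.pos x).ne'
  rw [gradientNormSq, gradientNormSq, gradient_conformal hφ, hφ.eq]
  simp only [map_smul, smul_apply, smul_eq_mul]
  field_simp

theorem volumeDensity_conformal {g h : Metric n M} {φ : M → ℝ} (hφ : IsConformalFactor g h φ)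
    (p : M) (z : EuclideanSpace ℝ (Fin n)) :
    volumeDensity h p z = Real.sqrt (chartRep p φ z ^ n) * volumeDensity g p z := by
  have h1 : gram h p z = chartRep p φ z • gram g p z := by
    ext i j
    exact hφ.eq _ _ _
  rw [volumeDensity, volumeDensity, h1, Matrix.det_smul, Fintype.card_fin, Real.sqrt_mul]
  exact pow_nonneg (hφ.pos _).le _

theorem coords_gradient_conformal {g h : Metric n M} {φ : M → ℝ} (hφ : IsConformalFactor g h φ)
    (f : M → ℝ) (p : M) (z : EuclideanSpace ℝ (Fin n)) :
    coords p (gradient h f) z = (chartRep p φ z)⁻¹ • coords p (gradient g f) z := by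
  rw [coords, gradient_conformal hφ, map_smul]
  rfl

/-- With ψ = φ^(n/2 − 1), the coordinate field √det h · ∇_h f equals ψ √det g · ∇_g f. The product
rule then splits off the derivative of ψ along ∇_g f. -/
theorem laplacian_conformal {g h : Metric n M} {φ : M → ℝ} (hφ : IsConformalFactor g h φ)
    {f : M → ℝ} (hf : ContMDiff (𝓡 n) 𝓘(ℝ, ℝ) ∞ f) (p : M) :
    laplacian h f p = (Real.sqrt (φ p ^ n))⁻¹ * (Real.sqrt (φ p ^ n) / φ p * laplacian g f p +
      fderiv ℝ (chartRep p fun x => Real.sqrt (φ x ^ n) / φ x) (extChartAt (𝓡 n) p p)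
        (coords p (gradient g f) (extChartAt (𝓡 n) p p))) := by
  set z₀ := extChartAt (𝓡 n) p p with hz₀
  set ψ : EuclideanSpace ℝ (Fin n) → ℝ := chartRep p fun x => Real.sqrt (φ x ^ n) / φ x with hψ
  set X := coords p (gradient g f) with hX
  set V := volumeDensity g p with hV
  have htarget : (extChartAt (𝓡 n) p).target ∈ 𝓝 z₀ :=
    (isOpen_extChartAt_target p).mem_nhds (mem_extChartAt_target p)
  have hφp := hφ.pos p
  have hψd : DifferentiableAt ℝ ψ z₀ := by
    have h1 : ContDiffAt ℝ ∞ (chartRep p φ) z₀ := (chartRep_contDiffAt hφ.smooth p).self_of_nhds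
    have h2 : chartRep p φ z₀ = φ p := chartRep_self p φ
    have h3 : ContDiffAt ℝ ∞ (fun z => Real.sqrt (chartRep p φ z ^ n) / chartRep p φ z) z₀ :=
      ((h1.pow n).sqrt (by rw [h2]; positivity)).div h1 (by rw [h2]; exact hφp.ne')
    exact h3.differentiableAt (by simp)
  have hVd : DifferentiableAt ℝ V z₀ :=
    ((contDiffOn_volumeDensity g p).contDiffAt htarget).differentiableAt (by simp)
  have hXd : DifferentiableAt ℝ X z₀ :=
    ((contDiffOn_coords_gradient g hf p).contDiffAt htarget).differentiableAt (by simp)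
  have hXj : ∀ j, DifferentiableAt ℝ (fun z => V z * X z j) z₀ := fun j =>
    hVd.mul ((EuclideanSpace.proj (𝕜 := ℝ) j).differentiableAt.comp z₀ hXd)
  have hfun : ∀ j, (fun z => volumeDensity h p z * coords p (gradient h f) z j) =
      fun z => ψ z * (V z * X z j) := fun j => by
    funext z
    rw [volumeDensity_conformal hφ, coords_gradient_conformal hφ, PiLp.smul_apply, smul_eq_mul, hψ]
    simp only [chartRep]
    rw [div_eq_mul_inv]; ring
  have hV0 : V z₀ ≠ 0 := (Real.sqrt_pos.2 (det_gram_pos g (mem_extChartAt_target p))).ne'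
  have hψ0 : ψ z₀ = Real.sqrt (φ p ^ n) / φ p := chartRep_self p _
  have hXsum : fderiv ℝ ψ z₀ (X z₀) =
      ∑ j, X z₀ j * fderiv ℝ ψ z₀ (EuclideanSpace.single j 1) := by
    have hv : X z₀ = ∑ j, X z₀ j • EuclideanSpace.single j (1 : ℝ) := by
      ext j
      simp [Finset.sum_apply, Pi.single_apply]
    conv_lhs => rw [hv, map_sum]
    simp
  rw [laplacian, laplacian, divergence, divergence, ← hz₀, volumeDensity_conformal hφ, ← hV,
    ← hX, chartRep_self]
  have hder : ∀ j, fderiv ℝ (fun z => volumeDensity h p z * coords p (gradient h f) z j) z₀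
      (EuclideanSpace.single j 1) = ψ z₀ * fderiv ℝ (fun z => V z * X z j) z₀
        (EuclideanSpace.single j 1) + V z₀ * (X z₀ j * fderiv ℝ ψ z₀ (EuclideanSpace.single j 1)) := by
    intro j
    rw [hfun, fderiv_fun_mul hψd (hXj j)]
    simp only [add_apply, smul_apply, smul_eq_mul]
    ring
  simp only [hder, Finset.sum_add_distrib, ← Finset.mul_sum, hXsum, hψ0]
  have hs : Real.sqrt (φ p ^ n) ≠ 0 := (Real.sqrt_pos.2 (pow_pos hφp n)).ne'
  rw [mul_inv]
  field_simp

end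

/-! ### The two implications and the comparison of f-conformal classes -/

section

variable {n : ℕ} {M : Type*} [TopologicalSpace M]
  [ChartedSpace (EuclideanSpace ℝ (Fin n)) M] [IsManifold (𝓡 n) ∞ M]

/-- If `f` is isoparametric for two conformal metrics, the conformal factor is constant along its
level sets. -/
theorem levelConstant_of_isIsoparametric [CompactSpace M] [ConnectedSpace M] {g h : Metric n M}
    {f φ : M → ℝ} (hg : IsIsoparametric g f) (hh : IsIsoparametric h f)
    (hφ : IsConformalFactor g h φ) : φ ∈ levelConstant f := by
  obtain ⟨b, hbs, hb⟩ := hg.gradient_eq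
  obtain ⟨b', hbs', hb'⟩ := hh.gradient_eq
  have hmul : ∀ x, φ x * b' (f x) = b (f x) := fun x => by
    rw [← hb, ← hb', gradientNormSq_conformal hφ, mul_inv_cancel_left₀ (hφ.pos x).ne']
  -- On a critical level the identity `hmul` reads 0 = 0. Dividing it by `f y - f x` and letting `y`
  -- tend to `x` through points off the level gives an identity between slopes.
  have hcrit : ∀ x, b (f x) = 0 →
      φ x * derivWithin b' (range f) (f x) = derivWithin b (range f) (f x) := by
    intro x h0
    have h0' : b' (f x) = 0 := by
      have := hmul x
      rw [h0] at this
      exact (mul_eq_zero.1 this).resolve_left (hφ.pos x).ne'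
    have hne := not_eventually_eq_of_zero g hg.smooth hg.nonconstant hb hbs h0
    have : (𝓝[{y | f y ≠ f x}] x).NeBot := by
      rw [← mem_closure_iff_nhdsWithin_neBot, mem_closure_iff_frequently]
      exact not_eventually.1 hne
    have hf : Tendsto f (𝓝[{y | f y ≠ f x}] x) (𝓝[range f \ {f x}] (f x)) := by
      refine tendsto_nhdsWithin_iff.2 ⟨hg.smooth.continuous.continuousAt.mono_left
        nhdsWithin_le_nhds, ?_⟩
      filter_upwards [self_mem_nhdsWithin] with y hy
      exact ⟨mem_range_self y, hy⟩
    have h1 := (hasDerivWithinAt_iff_tendsto_slope.1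
      ((hbs.differentiableOn (by simp)) _ (mem_range_self x)).hasDerivWithinAt).comp hf
    have h2 := (hasDerivWithinAt_iff_tendsto_slope.1
      ((hbs'.differentiableOn (by simp)) _ (mem_range_self x)).hasDerivWithinAt).comp hf
    have h3 : Tendsto φ (𝓝[{y | f y ≠ f x}] x) (𝓝 (φ x)) :=
      hφ.smooth.continuous.continuousAt.mono_left nhdsWithin_le_nhds
    refine tendsto_nhds_unique ((h3.mul h2).congr fun y => ?_) h1
    simp only [Function.comp_def, slope_def_field, h0, h0', sub_zero]
    rw [← mul_div_assoc, hmul]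
  intro x y hxy
  by_cases h0 : b (f x) = 0
  · have h1 := hcrit x h0
    have h2 := hcrit y (hxy ▸ h0)
    rw [← hxy, ← h1] at h2
    have h0' : b' (f x) = 0 := by
      have := hmul x
      rw [h0] at this
      exact (mul_eq_zero.1 this).resolve_left (hφ.pos x).ne'
    -- The derivative to cancel belongs to `b'`, so simplicity of the zeros is applied to the metric
    -- `h`.
    exact (mul_right_cancel₀ (derivWithin_ne_zero_of_zero h hh.smooth hh.nonconstant hb' hbs'
      (mem_range_self x) h0').1 h2).symm
  · have h1 := hmul x
    have h2 := hmul y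
    rw [← hxy, ← h1] at h2
    rw [← h1] at h0
    exact (mul_right_cancel₀ (right_ne_zero_of_mul h0) h2).symm

/-- A conformal change by a factor that is constant along the level sets of `f` keeps `f`
isoparametric. -/
theorem isIsoparametric_of_levelConstant [CompactSpace M] [ConnectedSpace M] {g h : Metric n M}
    {f φ : M → ℝ} (hg : IsIsoparametric g f) (hφ : IsConformalFactor g h φ)
    (hlevel : φ ∈ levelConstant f) : IsIsoparametric h f := by
  obtain ⟨b, hbs, hb⟩ := hg.gradient_eq
  obtain ⟨a, has, ha⟩ := hg.laplacian_eq
  obtain ⟨β, hβ⟩ := (Function.factorsThrough_iff φ).1 (fun x y hxy => hlevel x y hxy)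
  replace hβ : ∀ x, φ x = β (f x) := congrFun hβ
  have hβs : ContDiffOn ℝ ∞ β (range f) :=
    contDiffOn_range_of_comp g hg.smooth hg.nonconstant hb hbs hφ.smooth hβ
  have hβpos : ∀ t ∈ range f, 0 < β t := by
    rintro _ ⟨x, rfl⟩
    rw [← hβ]; exact hφ.pos x
  have hpow : ∀ t ∈ range f, 0 < β t ^ n := fun t ht => pow_pos (hβpos t ht) n
  have hsqrt : ContDiffOn ℝ ∞ (fun t => Real.sqrt (β t ^ n)) (range f) :=
    (hβs.pow n).sqrt fun t ht => (hpow t ht).ne'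
  -- This is β^(n/2 − 1), the factor in the Laplacian formula as a function of the value of f.
  set η : ℝ → ℝ := fun t => Real.sqrt (β t ^ n) / β t with hη
  have hηs : ContDiffOn ℝ ∞ η (range f) := hsqrt.div hβs fun t ht => (hβpos t ht).ne'
  have huniq : UniqueDiffOn ℝ (range f) := by
    obtain ⟨c, d, hcd, hr⟩ := exists_range_eq_Icc hg.smooth.continuous hg.nonconstant
    rw [hr]; exact uniqueDiffOn_Icc hcd
  have hη' : ContinuousOn (derivWithin η (range f)) (range f) :=
    ((contDiffOn_infty_iff_derivWithin huniq).1 hηs).2.continuousOn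
  refine ⟨hg.smooth, hg.nonconstant, ⟨fun t => (β t)⁻¹ * b t,
    (hβs.inv fun t ht => (hβpos t ht).ne').mul hbs, fun x => ?_⟩,
    ⟨fun t => (Real.sqrt (β t ^ n))⁻¹ * (η t * a t + derivWithin η (range f) t * b t), ?_,
      fun p => ?_⟩⟩
  · rw [gradientNormSq_conformal hφ, hb, hβ]
  · exact (hsqrt.continuousOn.inv₀ fun t ht => (Real.sqrt_pos.2 (hpow t ht)).ne').mul
      ((hηs.continuousOn.mul has).add (hη'.mul hbs.continuousOn))
  · rw [laplacian_conformal hφ hg.smooth, hβ p, ha]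
    change _ = _ * (_ + _ * b (f p))
    rw [← hb]
    have hψ : chartRep (n := n) p (fun x => Real.sqrt (φ x ^ n) / φ x) = η ∘ chartRep p f := by
      funext z
      simp only [chartRep, Function.comp_def, hη, hβ]
    have hfd : HasFDerivAt (chartRep p f) (fderiv ℝ (chartRep p f) (extChartAt (𝓡 n) p p))
        (extChartAt (𝓡 n) p p) :=
      ((chartRep_contDiffAt hg.smooth p).self_of_nhds.differentiableAt (by simp)).hasFDerivAt
    have hηd : HasDerivWithinAt η (derivWithin η (range f) (f p)) (range f)
        (chartRep p f (extChartAt (𝓡 n) p p)) := by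
      rw [chartRep_self]
      exact (hηs.differentiableOn (by simp) _ (mem_range_self p)).hasDerivWithinAt
    have hcomp := hηd.hasFDerivWithinAt.comp_hasFDerivAt _ hfd
      (Eventually.of_forall fun z => mem_range_self _)
    -- The derivative of η ∘ f along ∇_g f is η'(f)·|∇_g f|² = η'(f)·b(f), again a function of f.
    have hgrad := gradientNormSq_eq g hg.smooth (mem_extChartAt_target (I := 𝓡 n) p)
    rw [extChartAt_to_inv] at hgrad
    rw [hψ, hcomp.fderiv, hgrad]
    simp [hη, mul_comm]

theorem IsConformalFactor.mul {g h k : Metric n M} {φ ψ : M → ℝ} (hφ : IsConformalFactor g h φ)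
    (hψ : IsConformalFactor h k ψ) : IsConformalFactor g k fun x => ψ x * φ x where
  smooth := hψ.smooth.mul hφ.smooth
  pos x := mul_pos (hψ.pos x) (hφ.pos x)
  eq x v w := by rw [hψ.eq, hφ.eq, mul_assoc]

theorem IsConformalFactor.symm {g h : Metric n M} {φ : M → ℝ} (hφ : IsConformalFactor g h φ) :
    IsConformalFactor h g fun x => (φ x)⁻¹ where
  smooth := hφ.smooth.inv₀ fun x => (hφ.pos x).ne'
  pos x := inv_pos.2 (hφ.pos x)
  eq x v w := by rw [hφ.eq, inv_mul_cancel_left₀ (hφ.pos x).ne']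

theorem fConformalClass_subset {g h : Metric n M} {f φ : M → ℝ} (hφ : IsConformalFactor g h φ)
    (hlevel : φ ∈ levelConstant f) : fConformalClass h f ⊆ fConformalClass g f := by
  rintro k ⟨ψ, hψl, hψ⟩
  refine ⟨_, fun x y hxy => ?_, hφ.mul hψ⟩
  rw [hψl x y hxy, hlevel x y hxy]

/-- Since `h` lies in its own class with factor 1, equality puts it in the class of `g` with some
level-constant factor. A nonzero tangent vector, which needs `n ≠ 0`, shows that this factor is `φ`.
The converse composes factors, using `φ` one way and its inverse the other. -/
theorem fConformalClass_eq_iff {g h : Metric n M} {f φ : M → ℝ} (hn : n ≠ 0)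
    (hφ : IsConformalFactor g h φ) :
    fConformalClass h f = fConformalClass g f ↔ φ ∈ levelConstant f := by
  constructor
  · intro heq
    have hmem : h ∈ fConformalClass h f :=
      ⟨fun _ => 1, fun _ _ _ => rfl, contMDiff_const, fun _ => one_pos, fun x v w => (one_mul _).symm⟩
    rw [heq] at hmem
    obtain ⟨ψ, hψl, hψ⟩ := hmem
    have : φ = ψ := by
      funext x
      have : Nonempty (Fin n) := ⟨⟨0, Nat.pos_of_ne_zero hn⟩⟩
      obtain ⟨v, hv⟩ := exists_ne (0 : EuclideanSpace ℝ (Fin n))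
      have h1 : φ x * g.inner x v v = ψ x * g.inner x v v := (hφ.eq x v v).symm.trans (hψ.eq x v v)
      exact mul_right_cancel₀ (g.pos x v hv).ne' h1
    rwa [this]
  · intro hlevel
    refine (fConformalClass_subset hφ hlevel).antisymm (fConformalClass_subset hφ.symm ?_)
    intro x y hxy
    exact congrArg _ (hlevel x y hxy)

/-- A connected manifold of dimension 0 is a point, where every function is constant. -/
theorem IsIsoparametric.dim_ne_zero [ConnectedSpace M] {g : Metric n M} {f : M → ℝ}
    (hf : IsIsoparametric g f) : n ≠ 0 := by
  rintro rfl
  obtain ⟨x, y, hxy⟩ := hf.nonconstant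
  have : DiscreteTopology M := ChartedSpace.discreteTopology (EuclideanSpace ℝ (Fin 0)) M
  have := PreconnectedSpace.trivial_of_discrete (X := M)
  exact hxy (congrArg f (Subsingleton.elim x y))

end

end Isoparametric

end

theorem mainTheorem9 {n : ℕ} {M : Type*} [TopologicalSpace M] [T2Space M] [CompactSpace M]
    [ConnectedSpace M] [ChartedSpace (EuclideanSpace ℝ (Fin n)) M] [IsManifold (𝓡 n) ∞ M]
    (g h : Isoparametric.Metric n M) (f : M → ℝ)
    (hf : Isoparametric.IsIsoparametric g f)
    (hh : h ∈ Isoparametric.conformalClass g) :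
    (Isoparametric.IsIsoparametric h f ↔
      Isoparametric.fConformalClass h f = Isoparametric.fConformalClass g f) ∧
    ∀ φ : M → ℝ, Isoparametric.IsConformalFactor g h φ →
      (Isoparametric.fConformalClass h f = Isoparametric.fConformalClass g f ↔
        φ ∈ Isoparametric.levelConstant f) := by
  have hn := hf.dim_ne_zero
  refine ⟨?_, fun φ hφ => Isoparametric.fConformalClass_eq_iff hn hφ⟩
  obtain ⟨φ, hφ⟩ := hh
  rw [Isoparametric.fConformalClass_eq_iff hn hφ]
  exact ⟨fun hi => Isoparametric.levelConstant_of_isIsoparametric hf hi hφ,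
    Isoparametric.isIsoparametric_of_levelConstant hf hφ⟩
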